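/- **Theorem (Banach space valued $L^p$-extrapolation).** Let $d \ge 2$, let $X$ and $Y$ be complex Banach spaces, let $\Omega \subset \mathbb{R}^d$ be Lebesgue-measurable, let $\mathcal{M} > 0$, and let $T : L^2(\Omega;X) \to L^2(\Omega;Y)$ be a bounded linear operator with $\|T\|_{L^2(\Omega;X)\to L^2(\Omega;Y)} \le \mathcal{M}$. Suppose that there are constants $2 < p < \infty$, $R_0 \in (0,\infty]$, $\alpha_2 > \alpha_1 > 1$ and $\mathcal{C} > 0$, where $R_0 = \infty$ if $\operatorname{diam}(\Omega) = \infty$, such that the following holds. For every open ball $B = B(x_0,r)$ with $0 < r < R_0$ which is either centred on the boundary, i.e. $x_0 \in \partial\Omega$, or satisfies $\alpha_2 B \subset \Omega$, and for every $f \in L^\infty(\Omega;X)$ that vanishes almost everywhere outside some compact subset of $\Omega$ and satisfies $f = 0$ almost everywhere on $\Omega \cap \alpha_2 B$, $$\bigg( \frac{1}{r^d} \int_{\Omega \cap B} \| T f \|_Y^p \, dx \bigg)^{1/p} \le \mathcal{C} \bigg\{ \bigg( \frac{1}{r^d} \int_{\Omega \cap \alpha_1 B} \| T f \|_Y^2 \,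 dx \bigg)^{1/2} + \sup_{B' \supset B} \bigg( \frac{1}{|B'|} \int_{\Omega \cap B'} \| f \|_X^2 \, dx \bigg)^{1/2} \bigg\} .$$ Here $\alpha B := B(x_0, \alpha r)$, $|\cdot|$ is the Lebesgue measure, the supremum runs over all balls $B'$ containing $B$, and the inequality includes the assertion that the left-hand side is finite. Then for each $2 < q < p$ the restriction of $T$ to $L^2(\Omega;X) \cap L^q(\Omega;X)$ extends to a bounded linear operator from $L^q(\Omega;X)$ into $L^q(\Omega;Y)$, with operator norm bounded by a constant depending only on $d$, $p$, $q$, $\alpha_1$, $\alpha_2$, $\mathcal{C}$ and $\mathcal{M}$, and additionally on $R_0$ and $\operatorname{diam}(\Omega)$ if $\Omega$ is bounded. -/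

import Mathlib

open MeasureTheory Metric
open scoped ENNReal

/-- `f` belongs to `L^∞(Ω; X)` and has compact support: it vanishes almost everywhere in `Ω`
outside some compact subset of `Ω`. -/
def IsBoundedCompactlySupported {d : ℕ} {X : Type*} [NormedAddCommGroup X]
    (Ω : Set (EuclideanSpace ℝ (Fin d))) (f : EuclideanSpace ℝ (Fin d) → X) : Prop :=
  MemLp f ∞ (volume.restrict Ω) ∧
    ∃ K : Set (EuclideanSpace ℝ (Fin d)), IsCompact K ∧ K ⊆ Ω ∧
      ∀ᵐ x ∂(volume.restrict Ω), x ∉ K → f x = 0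

/-- `( r^{-d} ∫_{Ω ∩ B(x₀, ρ)} ‖u‖^s dx )^{1/s}`, as an element of `[0, ∞]`. -/
noncomputable def scaledLpMean {d : ℕ} {X : Type*} [NormedAddCommGroup X]
    (Ω : Set (EuclideanSpace ℝ (Fin d))) (u : EuclideanSpace ℝ (Fin d) → X)
    (s r : ℝ) (x₀ : EuclideanSpace ℝ (Fin d)) (ρ : ℝ) : ℝ≥0∞ :=
  ((∫⁻ x in Ω ∩ ball x₀ ρ, ‖u x‖ₑ ^ s) / ENNReal.ofReal (r ^ d)) ^ (1 / s)

/-- `sup_{B' ⊇ B} ( |B'|^{-1} ∫_{Ω ∩ B'} ‖u‖² dx )^{1/2}`, where `B = B(x₀, r)` and the supremum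
runs over all balls `B' = B(y, ρ)`, `ρ > 0`, containing `B`. -/
noncomputable def supL2Average {d : ℕ} {X : Type*} [NormedAddCommGroup X]
    (Ω : Set (EuclideanSpace ℝ (Fin d))) (u : EuclideanSpace ℝ (Fin d) → X)
    (x₀ : EuclideanSpace ℝ (Fin d)) (r : ℝ) : ℝ≥0∞ :=
  ⨆ (y : EuclideanSpace ℝ (Fin d)) (ρ : ℝ) (_ : 0 < ρ) (_ : ball x₀ r ⊆ ball y ρ),
    ((∫⁻ x in Ω ∩ ball y ρ, ‖u x‖ₑ ^ (2 : ℝ)) / volume (ball y ρ)) ^ (1 / 2 : ℝ)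

/-- The weak reverse Hölder estimate with exponent `p` and constant `C`, for all balls
`B = B(x₀, r)`, `0 < r < R₀`, that are centred on `∂Ω` or satisfy `α₂ B ⊆ Ω`, and all compactly
supported `f ∈ L^∞(Ω; X)` (hence `f ∈ L²(Ω; X)`) with `f = 0` on `Ω ∩ α₂ B`. -/
def WeakReverseHolder {d : ℕ} {X Y : Type*}
    [NormedAddCommGroup X] [NormedSpace ℂ X] [NormedAddCommGroup Y] [NormedSpace ℂ Y]
    (Ω : Set (EuclideanSpace ℝ (Fin d)))
    (T : Lp X 2 (volume.restrict Ω) →L[ℂ] Lp Y 2 (volume.restrict Ω))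
    (p α₁ α₂ C : ℝ) (R₀ : ℝ≥0∞) : Prop :=
  ∀ (x₀ : EuclideanSpace ℝ (Fin d)) (r : ℝ), 0 < r → ENNReal.ofReal r < R₀ →
    (x₀ ∈ frontier Ω ∨ ball x₀ (α₂ * r) ⊆ Ω) →
    ∀ f : Lp X 2 (volume.restrict Ω), IsBoundedCompactlySupported Ω f →
      (∀ᵐ x ∂(volume.restrict (Ω ∩ ball x₀ (α₂ * r))), f x = 0) →
      scaledLpMean Ω (T f) p r x₀ r ≤
        ENNReal.ofReal C *
          (scaledLpMean Ω (T f) 2 r x₀ (α₁ * r) + supL2Average Ω f x₀ r)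

/-!
The proof is a good-λ argument carried out directly on stopping balls, without maximal functions.
Let `u = ‖T f‖` for a bounded compactly supported `f`, and consider, at level one,
`G = u ^ 2 + ‖f‖ ^ 2 / ε ^ 2` on `Ω`. Almost every point at which `G > 1` is the centre of a
stopping ball: the average of `G` over it is at least one, while the averages over all concentric
balls of at least twice the radius are at most one (`ae_exists_isStoppingRadius`).

Around a stopping ball there is a comparable ball that is admissible in the weak reverse Hölder
estimate: either a dilate of the stopping ball lies in `Ω`, or it meets `∂Ω` and can be recentred
there. With respect to this ball `f` splits into a near part, which is small in `L ^ 2` because the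
averages of `‖f‖ ^ 2` are at most `ε ^ 2`, and a far part, whose image under `T` is bounded in
`L ^ p`. Hence the integral of `u ^ 2` over the part of the ball where `u > H` is at
most `K (ε ^ 2 + H ^ (2 - p))` times the measure of the ball
(`setLIntegral_closedBall_rpow_two_le`). By Vitali's covering theorem
and the stopping condition (`measure_univ_le_of_isStoppingRadius`), and by homogeneity, this gives
for all levels `s` the inequality (`setLIntegral_lt_norm_le`)
`∫_{u > H s} u ^ 2 ≤ 2 η (∫_{u > s / 2} u ^ 2 + ε ^ (-2) ∫_{‖f‖ > ε s / 2} ‖f‖ ^ 2)` with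
`η = K (ε ^ 2 + H ^ (2 - p))`.

Integrating against `s ^ (q - 3) ds` produces `∫ u ^ q` on both sides. Since `q < p`, first `H` can
be chosen large and then `ε` small such that the term on the right is absorbed; it is enough to do
so for truncations, whose moments are finite since `u ∈ L ^ 2` (`lintegral_rpow_le_of_goodLambda`). If
`Ω` is bounded, `R₀` may be finite, and the stopping radii are known to be small enough only for
levels above a multiple of `‖f‖₂`; the lower levels contribute a multiple of `‖f‖₂ ^ q`, which
Hölder's inequality controls.

Finally, Fatou's lemma extends the bound from bounded compactly supported functions to
`L ^ 2`, and density of `L ^ 2 ∩ L ^ q` in `L ^ q` yields the extension of `T`.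
-/

/-! ### Absorption of a good-λ inequality -/

/-- If the tail of `v` beyond `s` is, up to a small factor `η`, controlled by the tails of `v`
beyond `s / b` and of `w` beyond `s`, and the loss `η b ^ a` is at most `1 / 2`, then the
tail of `v` can be absorbed. The absorption takes place at the level of the truncations
`min v n`, whose `a`-th moments are finite because `μ` is. -/
theorem lintegral_rpow_le_of_goodLambda {α β : Type*} [MeasurableSpace α] [MeasurableSpace β]
    (μ : Measure α) [IsFiniteMeasure μ] (ν : Measure β) {v : α → ℝ} {w : β → ℝ}
    (hv0 : ∀ x, 0 ≤ v x) (hw0 : ∀ x, 0 ≤ w x) (hv : AEMeasurable v μ) (hw : AEMeasurable w ν)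
    {a b σ : ℝ} (ha : 0 < a) (hb : 1 ≤ b) (hσ : 0 ≤ σ) {η : ℝ≥0∞} (hη : η ≠ ∞)
    (hηb : η * ENNReal.ofReal (b ^ a) ≤ 1 / 2)
    (h : ∀ s, 0 < s → σ ≤ s → μ {x | s < v x} ≤ η * (μ {x | s < b * v x} + ν {x | s < w x})) :
    ∫⁻ x, ENNReal.ofReal (v x ^ a) ∂μ ≤
      2 * (ENNReal.ofReal (σ ^ a) * μ Set.univ + η * ∫⁻ x, ENNReal.ofReal (w x ^ a) ∂ν) := by
  have hb0 : 0 < b := by linarith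
  set D := ENNReal.ofReal (σ ^ a) * μ Set.univ + η * ∫⁻ x, ENNReal.ofReal (w x ^ a) ∂ν with hD
  -- The bound for the truncation of `v` at height `n`.
  have key : ∀ n : ℕ, ∫⁻ x, ENNReal.ofReal (min (v x) n ^ a) ∂μ ≤ 2 * D := by
    intro n
    set V : α → ℝ := fun x => min (v x) n with hV
    have hV0 : ∀ x, 0 ≤ V x := fun x => le_min (hv0 x) (Nat.cast_nonneg n)
    have hVm : AEMeasurable V μ := hv.min aemeasurable_const
    have hfin : ∫⁻ x, ENNReal.ofReal (V x ^ a) ∂μ ≠ ∞ := by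
      refine ne_of_lt (lt_of_le_of_lt (lintegral_mono
        (g := fun _ => ENNReal.ofReal ((n : ℝ) ^ a)) fun x => ?_) ?_)
      · exact ENNReal.ofReal_le_ofReal (Real.rpow_le_rpow (hV0 x) (min_le_right _ _) ha.le)
      · rw [lintegral_const]
        exact ENNReal.mul_lt_top ENNReal.ofReal_lt_top (measure_lt_top _ _)
    have tail : ∀ s, 0 < s → μ {x | s < V x} ≤
        μ {_x | s < σ} + η * (μ {x | s < b * V x} + ν {x | s < w x}) := by
      intro s hs
      rcases lt_or_ge s σ with hsσ | hsσ
      · exact le_add_right (measure_mono fun x _ => hsσ)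
      · rcases lt_or_ge s n with hsn | hsn
        · refine le_add_left ?_
          refine le_trans (measure_mono fun x hx => ?_) (le_trans (h s hs hsσ) ?_)
          · exact lt_of_lt_of_le (show s < min (v x) n from hx) (min_le_left _ _)
          · refine mul_le_mul_right (add_le_add_left (measure_mono fun x hx => ?_) _) _
            change s < b * v x at hx
            change s < b * min (v x) n
            rw [mul_min_of_nonneg _ _ hb0.le]
            exact lt_min hx (lt_of_lt_of_le hsn (le_mul_of_one_le_left (Nat.cast_nonneg n) hb))
        · have : {x | s < V x} = ∅ := by
            ext x
            simp only [Set.mem_ofPred_eq, Set.mem_empty_iff_false, iff_false, not_lt]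
            exact (min_le_right _ _).trans hsn
          rw [this]; simp
    have m1 : AEMeasurable (fun s : ℝ => μ {_x : α | s < σ} * ENNReal.ofReal (s ^ (a - 1)))
        (volume.restrict (Set.Ioi 0)) := by
      refine AEMeasurable.mul ?_ (by fun_prop)
      exact (Antitone.measurable (f := fun s : ℝ => μ {_x : α | s < σ}) fun s t hst =>
        measure_mono fun x hx => lt_of_le_of_lt hst hx).aemeasurable
    have m2 : AEMeasurable (fun s : ℝ => μ {x : α | s < b * V x} * ENNReal.ofReal (s ^ (a - 1)))
        (volume.restrict (Set.Ioi 0)) := by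
      refine AEMeasurable.mul ?_ (by fun_prop)
      exact (Antitone.measurable (f := fun s : ℝ => μ {x : α | s < b * V x}) fun s t hst =>
        measure_mono fun x hx => lt_of_le_of_lt hst hx).aemeasurable
    have main : ∫⁻ x, ENNReal.ofReal (V x ^ a) ∂μ ≤
        D + η * ∫⁻ x, ENNReal.ofReal ((b * V x) ^ a) ∂μ := by
      have hc : ENNReal.ofReal (σ ^ a) * μ Set.univ = ∫⁻ _x, ENNReal.ofReal (σ ^ a) ∂μ := by
        rw [lintegral_const]
      rw [hD, hc]
      rw [lintegral_rpow_eq_lintegral_meas_lt_mul μ (Filter.Eventually.of_forall hV0) hVm ha,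
        lintegral_rpow_eq_lintegral_meas_lt_mul μ (f := fun _ => σ)
          (Filter.Eventually.of_forall fun _ => hσ) aemeasurable_const ha,
        lintegral_rpow_eq_lintegral_meas_lt_mul μ (f := fun x => b * V x)
          (Filter.Eventually.of_forall fun x => mul_nonneg hb0.le (hV0 x)) (hVm.const_mul b) ha,
        lintegral_rpow_eq_lintegral_meas_lt_mul ν (Filter.Eventually.of_forall hw0) hw ha]
      set I1 := ∫⁻ s in Set.Ioi (0 : ℝ), μ {_x : α | s < σ} * ENNReal.ofReal (s ^ (a - 1))
      set I2 := ∫⁻ s in Set.Ioi (0 : ℝ), μ {x : α | s < b * V x} * ENNReal.ofReal (s ^ (a - 1))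
        with hI2
      set I3 := ∫⁻ s in Set.Ioi (0 : ℝ), ν {x : β | s < w x} * ENNReal.ofReal (s ^ (a - 1))
        with hI3
      have : ∫⁻ s in Set.Ioi (0 : ℝ), μ {x : α | s < V x} * ENNReal.ofReal (s ^ (a - 1)) ≤
          I1 + (η * I2 + η * I3) := by
        rw [hI2, hI3, ← lintegral_const_mul' _ _ hη, ← lintegral_const_mul' _ _ hη,
          ← lintegral_add_left' (m2.const_mul η), ← lintegral_add_left' m1]
        refine setLIntegral_mono' measurableSet_Ioi fun s hs => ?_
        calc _ ≤ (μ {_x | s < σ} + η * (μ {x | s < b * V x} + ν {x | s < w x})) *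
              ENNReal.ofReal (s ^ (a - 1)) := by gcongr; exact tail s hs
          _ = _ := by ring
      calc _ ≤ ENNReal.ofReal a * (I1 + (η * I2 + η * I3)) := by gcongr
        _ = _ := by ring
    have hhalf : η * ∫⁻ x, ENNReal.ofReal ((b * V x) ^ a) ∂μ ≤
        (∫⁻ x, ENNReal.ofReal (V x ^ a) ∂μ) / 2 := by
      have : ∀ x, ENNReal.ofReal ((b * V x) ^ a) =
          ENNReal.ofReal (b ^ a) * ENNReal.ofReal (V x ^ a) := fun x => by
        rw [Real.mul_rpow hb0.le (hV0 x), ENNReal.ofReal_mul (by positivity)]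
      simp only [this]
      rw [lintegral_const_mul' _ _ ENNReal.ofReal_ne_top, ← mul_assoc, ENNReal.div_eq_inv_mul]
      gcongr
      simpa using hηb
    set I := ∫⁻ x, ENNReal.ofReal (V x ^ a) ∂μ
    have h2 : I / 2 + I / 2 ≤ D + I / 2 := by
      rw [ENNReal.add_halves]; exact main.trans (by gcongr)
    have h3 : I / 2 ≤ D :=
      (ENNReal.add_le_add_iff_right (ENNReal.div_ne_top hfin (by norm_num))).1 h2
    calc I = I / 2 + I / 2 := (ENNReal.add_halves I).symm
      _ ≤ D + D := by gcongr
      _ = 2 * D := by ring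
  -- Monotone convergence removes the truncation.
  have hsup : ∀ x, ENNReal.ofReal (v x ^ a) = ⨆ n : ℕ, ENNReal.ofReal (min (v x) n ^ a) := by
    intro x
    refine le_antisymm ?_ (iSup_le fun n => ENNReal.ofReal_le_ofReal
      (Real.rpow_le_rpow (le_min (hv0 x) (Nat.cast_nonneg n)) (min_le_left _ _) ha.le))
    obtain ⟨n, hn⟩ := exists_nat_ge (v x)
    refine le_iSup_of_le n ?_
    rw [min_eq_left hn]
  simp only [hsup]
  rw [lintegral_iSup' (fun n => by fun_prop) ?_]
  · exact iSup_le key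
  · refine Filter.Eventually.of_forall fun x m n hmn => ENNReal.ofReal_le_ofReal
      (Real.rpow_le_rpow (le_min (hv0 x) (Nat.cast_nonneg m)) (min_le_min le_rfl ?_) ha.le)
    exact_mod_cast hmn

/-! ### Stopping balls -/

section Stopping

variable {E : Type*} [NormedAddCommGroup E] [MeasurableSpace E] (μ : Measure E)

/-- `r` is a stopping radius for `G` at `x`, at level one: the average of `G` over the ball of
radius `r` is at least one, while the averages over all concentric balls of radius at least
`2 r` are at most one. The factor `2` spares the discussion of whether a supremum of radii is
attained. -/
def IsStoppingRadius (G : E → ℝ≥0∞) (x : E) (r : ℝ) : Prop :=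
  0 < r ∧ μ (closedBall x r) ≤ ∫⁻ y in closedBall x r, G y ∂μ ∧
    ∀ ρ, 2 * r ≤ ρ → ∫⁻ y in closedBall x ρ, G y ∂μ ≤ μ (closedBall x ρ)

theorem lt_of_measure_closedBall_lt [BorelSpace E] [μ.IsAddHaarMeasure] {x : E} {r R : ℝ}
    (h : μ (closedBall x r) < μ (closedBall 0 R)) : r < R := by
  by_contra! hle
  rw [Measure.addHaar_closedBall_center] at h
  exact absurd h (not_lt.2 (measure_mono (closedBall_subset_closedBall hle)))

theorem IsStoppingRadius.lt [BorelSpace E] [μ.IsAddHaarMeasure] {G : E → ℝ≥0∞} {x : E} {r R : ℝ}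
    (h : IsStoppingRadius μ G x r)
    (hR : ∫⁻ y, G y ∂μ < μ (closedBall 0 R)) : r < R :=
  lt_of_measure_closedBall_lt μ (h.2.1.trans_lt ((setLIntegral_le_lintegral _ _).trans_lt hR))

variable [NormedSpace ℝ E] [FiniteDimensional ℝ E] [BorelSpace E] [μ.IsAddHaarMeasure]

theorem exists_lt_measure_closedBall [Nontrivial E] {I : ℝ≥0∞} (hI : I ≠ ∞) :
    ∃ R : ℝ, 0 < R ∧ I < μ (closedBall 0 R) := by
  have h : Filter.Tendsto (fun n : ℕ => μ (closedBall (0 : E) n)) Filter.atTop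
      (nhds (μ (⋃ n : ℕ, closedBall (0 : E) n))) :=
    tendsto_measure_iUnion_atTop fun m n hmn => closedBall_subset_closedBall (by exact_mod_cast hmn)
  have huniv : μ (⋃ n : ℕ, closedBall (0 : E) n) = ∞ := by
    rw [iUnion_closedBall_nat, measure_univ_of_isAddLeftInvariant]
  rw [huniv] at h
  obtain ⟨n, hn1, hn2⟩ := ((h.eventually (lt_mem_nhds hI.lt_top)).and
    (Filter.eventually_gt_atTop 0)).exists
  exact ⟨n, by exact_mod_cast hn2, hn1⟩

/-- By Lebesgue differentiation almost every point where `G` exceeds one has a stopping radius. -/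
theorem ae_exists_isStoppingRadius [Nontrivial E] {G : E → ℝ≥0∞} (hG : AEMeasurable G μ)
    (hGi : ∫⁻ y, G y ∂μ ≠ ∞) : ∀ᵐ x ∂μ, 1 < G x → ∃ r, IsStoppingRadius μ G x r := by
  obtain ⟨R, hR0, hR⟩ := exists_lt_measure_closedBall μ hGi
  filter_upwards [(Besicovitch.vitaliFamily μ).ae_tendsto_lintegral_div hG hGi] with x hx hGx
  have h1 := (hx.comp (Besicovitch.tendsto_filterAt μ x)).eventually (lt_mem_nhds hGx)
  obtain ⟨r₀, hr₀, hr₀pos⟩ := (h1.and self_mem_nhdsWithin).exists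
  set S : Set ℝ := {r | 0 < r ∧ μ (closedBall x r) ≤ ∫⁻ y in closedBall x r, G y ∂μ} with hS
  have hSbd : BddAbove S := ⟨R, fun r hr => (lt_of_measure_closedBall_lt μ
    (hr.2.trans_lt ((setLIntegral_le_lintegral _ _).trans_lt hR))).le⟩
  have hr₀S : r₀ ∈ S := by
    refine ⟨hr₀pos, ?_⟩
    have hlt : 1 < (∫⁻ y in closedBall x r₀, G y ∂μ) / μ (closedBall x r₀) := hr₀
    rw [ENNReal.lt_div_iff_mul_lt (Or.inl (measure_closedBall_pos μ x hr₀pos).ne')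
      (Or.inl measure_closedBall_lt_top.ne), one_mul] at hlt
    exact hlt.le
  have hsup : 0 < sSup S := lt_of_lt_of_le hr₀pos (le_csSup hSbd hr₀S)
  obtain ⟨r, hrS, hr⟩ := exists_lt_of_lt_csSup ⟨r₀, hr₀S⟩ (half_lt_self hsup)
  refine ⟨r, hrS.1, hrS.2, fun ρ hρ => ?_⟩
  by_contra! hlt
  have hρS : ρ ∈ S := ⟨by linarith [hrS.1], hlt.le⟩
  linarith [le_csSup hSbd hρS]

/-- If `ν` is concentrated on points at which `G` exceeds one and, on the fivefold enlargement of
each stopping ball, is bounded by `η` times the `μ`-measure of that ball, then the total mass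
of `ν` is bounded by `2 η` times the integral of the large part `G₁` of `G`: a disjoint
subfamily of stopping balls has enlargements that cover almost everything, and on each of
them the part of `G` that is at most `1 / 2` carries at most half of the integral. -/
theorem measure_univ_le_of_isStoppingRadius [Nontrivial E] {G G₁ : E → ℝ≥0∞}
    (hG : AEMeasurable G μ) (hGi : ∫⁻ y, G y ∂μ ≠ ∞) (hGG₁ : ∀ x, G x ≤ G₁ x + 1 / 2)
    {ν : Measure E} (hνμ : ν ≪ μ) {η : ℝ≥0∞}
    (hν : ∀ᵐ x ∂ν, 1 < G x ∧
      ∀ r, IsStoppingRadius μ G x r → ν (closedBall x (5 * r)) ≤ η * μ (closedBall x r)) :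
    ν Set.univ ≤ 2 * η * ∫⁻ x, G₁ x ∂μ := by
  obtain ⟨R, hR0, hR⟩ := exists_lt_measure_closedBall μ hGi
  set t : Set (E × ℝ) := {a | IsStoppingRadius μ G a.1 a.2 ∧
    ν (closedBall a.1 (5 * a.2)) ≤ η * μ (closedBall a.1 a.2)} with ht
  obtain ⟨u, hut, hdisj, hcov⟩ := Vitali.exists_disjoint_subfamily_covering_enlargement_closedBall
    t (fun a => a.1) (fun a => a.2) R (fun a ha => (ha.1.lt μ hR).le) 5 (by norm_num)
  have hcount : u.Countable := hdisj.countable_of_nonempty_interior fun a ha =>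
    ⟨a.1, ball_subset_interior_closedBall (mem_ball_self (hut ha).1.1)⟩
  have hfull : ∀ᵐ x ∂ν, x ∈ ⋃ a ∈ u, closedBall a.1 (5 * a.2) := by
    filter_upwards [hν, hνμ.ae_le (ae_exists_isStoppingRadius μ hG hGi)] with x hx1 hx2
    obtain ⟨r, hr⟩ := hx2 hx1.1
    obtain ⟨b, hb, hsub⟩ := hcov (x, r) ⟨hr, hx1.2 r hr⟩
    exact Set.mem_biUnion hb (hsub (mem_closedBall_self hr.1.le))
  have hball : ∀ a ∈ u, μ (closedBall a.1 a.2) ≤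
      2 * ∫⁻ y in closedBall a.1 a.2, G₁ y ∂μ := by
    intro a ha
    have hle : μ (closedBall a.1 a.2) / 2 + μ (closedBall a.1 a.2) / 2 ≤
        (∫⁻ y in closedBall a.1 a.2, G₁ y ∂μ) + μ (closedBall a.1 a.2) / 2 := by
      rw [ENNReal.add_halves]
      calc _ ≤ ∫⁻ y in closedBall a.1 a.2, G y ∂μ := (hut ha).1.2.1
        _ ≤ ∫⁻ y in closedBall a.1 a.2, (G₁ y + 1 / 2) ∂μ := lintegral_mono fun y => hGG₁ y
        _ = _ := by
          rw [lintegral_add_right _ measurable_const, setLIntegral_const, one_div,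
            ENNReal.div_eq_inv_mul]
    have hle' := (ENNReal.add_le_add_iff_right
      (ENNReal.div_ne_top measure_closedBall_lt_top.ne (by norm_num))).1 hle
    calc _ = 2 * (μ (closedBall a.1 a.2) / 2) := (ENNReal.mul_div_cancel (by norm_num)
          (by norm_num)).symm
      _ ≤ _ := by gcongr
  calc ν Set.univ ≤ ν (⋃ a ∈ u, closedBall a.1 (5 * a.2)) := by
        refine measure_mono_ae ?_
        filter_upwards [hfull] with x hx _ using hx
    _ ≤ ∑' a : u, ν (closedBall a.1.1 (5 * a.1.2)) := measure_biUnion_le ν hcount _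
    _ ≤ ∑' a : u, 2 * η * ∫⁻ y in closedBall a.1.1 a.1.2, G₁ y ∂μ := by
        refine ENNReal.tsum_le_tsum fun a => ?_
        calc _ ≤ η * μ (closedBall a.1.1 a.1.2) := (hut a.2).2
          _ ≤ η * (2 * ∫⁻ y in closedBall a.1.1 a.1.2, G₁ y ∂μ) := by
            gcongr; exact hball a.1 a.2
          _ = _ := by ring
    _ = 2 * η * ∫⁻ y in ⋃ a ∈ u, closedBall a.1 a.2, G₁ y ∂μ := by
        rw [ENNReal.tsum_mul_left,
          lintegral_biUnion hcount (fun a _ => measurableSet_closedBall) hdisj]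
    _ ≤ _ := by gcongr; exact Measure.restrict_le_self

end Stopping

/-! ### The estimate on one stopping ball -/

theorem IsPreconnected.exists_mem_frontier {E : Type*} [TopologicalSpace E] {s Ω : Set E}
    (hs : IsPreconnected s) (h₁ : (s ∩ Ω).Nonempty) (h₂ : (s ∩ Ωᶜ).Nonempty) :
    (s ∩ frontier Ω).Nonempty := by
  by_contra hne
  rw [Set.not_nonempty_iff_eq_empty] at hne
  have hmem : ∀ x ∈ s, x ∈ closure Ω → x ∈ interior Ω := fun x hx hxc => by
    by_contra hxi
    exact (hne ▸ (⟨hx, hxc, hxi⟩ : x ∈ s ∩ frontier Ω) : x ∈ (∅ : Set E))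
  obtain ⟨x, hx, hxΩ⟩ := h₁
  obtain ⟨y, hy, hyΩ⟩ := h₂
  obtain ⟨z, -, hz₁, hz₂⟩ := hs (interior Ω) (closure Ω)ᶜ isOpen_interior
    isClosed_closure.isOpen_compl
    (fun w hw => (em (w ∈ closure Ω)).imp (hmem w hw) id)
    ⟨x, hx, hmem x hx (subset_closure hxΩ)⟩
    ⟨y, hy, fun hyc => hyΩ (interior_subset (hmem y hy hyc))⟩
  exact hz₂ (interior_subset_closure hz₁)

/-- Around every point of `Ω` there is, up to enlarging the radius by the factor `α + 1`, a ball
that is admissible in the weak reverse Hölder estimate. If the dilated ball leaves `Ω`, it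
contains a boundary point, which then serves as the new centre. -/
theorem exists_ball_frontier_or_subset {E : Type*} [NormedAddCommGroup E] [NormedSpace ℝ E]
    {Ω : Set E} {x : E} (hx : x ∈ Ω) {ρ α : ℝ} (hρ : 0 < ρ) (hα : 0 < α) :
    ∃ (x₀ : E) (R : ℝ), (x₀ ∈ frontier Ω ∨ ball x₀ (α * R) ⊆ Ω) ∧ ρ ≤ R ∧ R ≤ (α + 1) * ρ ∧
      ball x ρ ⊆ ball x₀ R ∧ dist x x₀ < R := by
  by_cases h : ball x (α * ρ) ⊆ Ω
  · exact ⟨x, ρ, Or.inr h, le_rfl, by nlinarith, le_rfl, by simpa using hρ⟩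
  · obtain ⟨y, hy, hyΩ⟩ := Set.not_subset.1 h
    obtain ⟨z, hz, hzΩ⟩ := (convex_ball x (α * ρ)).isPreconnected.exists_mem_frontier
      ⟨x, mem_ball_self (by positivity), hx⟩ ⟨y, hy, hyΩ⟩
    rw [mem_ball] at hz
    refine ⟨z, (α + 1) * ρ, Or.inl hzΩ, by nlinarith, le_rfl, ?_, ?_⟩
    · refine ball_subset_ball' ?_
      rw [dist_comm]; nlinarith
    · rw [dist_comm]; nlinarith

theorem volume_closedBall_mul {d : ℕ} (x y : EuclideanSpace ℝ (Fin d)) {k r : ℝ} (hk : 0 ≤ k)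
    (hr : 0 ≤ r) : volume (closedBall x (k * r)) =
      ENNReal.ofReal k ^ d * volume (closedBall y r) := by
  rw [Measure.addHaar_closedBall _ _ (mul_nonneg hk hr), Measure.addHaar_closedBall _ _ hr,
    finrank_euclideanSpace_fin, mul_pow, ENNReal.ofReal_mul (by positivity),
    ENNReal.ofReal_pow hk, mul_assoc]

theorem lintegral_enorm_rpow_two_eq {α X : Type*} [MeasurableSpace α] {μ : Measure α}
    [NormedAddCommGroup X] (f : Lp X 2 μ) :
    ∫⁻ x, ‖f x‖ₑ ^ (2 : ℝ) ∂μ = ‖f‖ₑ ^ (2 : ℝ) := by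
  rw [Lp.enorm_def, eLpNorm_eq_lintegral_rpow_enorm_toReal (by norm_num) (by norm_num),
    ← ENNReal.rpow_mul]
  norm_num

theorem lintegral_enorm_rpow_two_ne_top {α X : Type*} [MeasurableSpace α] {μ : Measure α}
    [NormedAddCommGroup X] (f : Lp X 2 μ) : ∫⁻ x, ‖f x‖ₑ ^ (2 : ℝ) ∂μ ≠ ∞ := by
  rw [lintegral_enorm_rpow_two_eq]
  exact ENNReal.rpow_ne_top_of_nonneg (by norm_num) enorm_ne_top

theorem lintegral_enorm_clm_rpow_two_le {α X Y : Type*} [MeasurableSpace α] {μ : Measure α}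
    [NormedAddCommGroup X] [NormedSpace ℂ X] [NormedAddCommGroup Y] [NormedSpace ℂ Y]
    (T : Lp X 2 μ →L[ℂ] Lp Y 2 μ) {M : ℝ} (hM : ‖T‖ ≤ M) (f : Lp X 2 μ) :
    ∫⁻ x, ‖T f x‖ₑ ^ (2 : ℝ) ∂μ ≤
      ENNReal.ofReal M ^ (2 : ℝ) * ∫⁻ x, ‖f x‖ₑ ^ (2 : ℝ) ∂μ := by
  rw [lintegral_enorm_rpow_two_eq, lintegral_enorm_rpow_two_eq,
    ← ENNReal.mul_rpow_of_nonneg _ _ (by norm_num)]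
  refine ENNReal.rpow_le_rpow ?_ (by norm_num)
  have h0 : 0 ≤ M := (norm_nonneg T).trans hM
  rw [← ofReal_norm, ← ofReal_norm, ← ENNReal.ofReal_mul h0]
  exact ENNReal.ofReal_le_ofReal (T.le_of_opNorm_le hM f)

/-- Where a sum is large, its square is controlled by the square of the first summand and, by
Chebyshev's inequality, by a small multiple of the `p`-th power of the second one. -/
theorem ENNReal.rpow_two_le_of_lt_of_le_add {a b c H : ℝ≥0∞} {p : ℝ} (hp : 2 ≤ p)
    (hb : b ≠ ∞) (hc : c ≤ a + b) (hH : H < c) :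
    c ^ (2 : ℝ) ≤ 4 * a ^ (2 : ℝ) + 4 * ((H / 2) ^ (2 - p) * b ^ p) := by
  have h4 : (2 : ℝ≥0∞) ^ (2 : ℝ) = 4 := by
    rw [ENNReal.rpow_two]; norm_num
  rcases le_total b a with hba | hab
  · refine le_add_right ?_
    rw [← h4, ← ENNReal.mul_rpow_of_nonneg _ _ (by norm_num)]
    refine ENNReal.rpow_le_rpow (hc.trans ?_) (by norm_num)
    rw [two_mul]; gcongr
  · refine le_add_left ?_
    have hcb : c ≤ 2 * b := hc.trans (by rw [two_mul]; gcongr)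
    have hHb : H / 2 ≤ b := by
      rw [ENNReal.div_le_iff (by norm_num) (by norm_num), mul_comm]
      exact hH.le.trans hcb
    have hb0 : b ≠ 0 := by
      rintro rfl
      simp only [mul_zero, nonpos_iff_eq_zero] at hcb
      simp [hcb] at hH
    calc c ^ (2 : ℝ) ≤ (2 * b) ^ (2 : ℝ) := ENNReal.rpow_le_rpow hcb (by norm_num)
      _ = 4 * (b ^ (2 - p) * b ^ p) := by
        rw [ENNReal.mul_rpow_of_nonneg _ _ (by norm_num), h4, ← ENNReal.rpow_add _ _ hb0 hb]
        simp
      _ ≤ _ := by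
        gcongr 4 * (?_ * _)
        rw [← neg_sub p 2, ENNReal.rpow_neg, ENNReal.rpow_neg]
        exact ENNReal.inv_le_inv.2 (ENNReal.rpow_le_rpow hHb (by linarith))

theorem exists_Lp_indicator_add {α X : Type*} [MeasurableSpace α] {μ : Measure α}
    [NormedAddCommGroup X] {p : ℝ≥0∞} (f : Lp X p μ) {A : Set α} (hA : MeasurableSet A) :
    ∃ f₁ f₂ : Lp X p μ, f = f₁ + f₂ ∧ f₁ =ᵐ[μ] A.indicator f ∧ f₂ =ᵐ[μ] Aᶜ.indicator f := by
  refine ⟨((Lp.memLp f).indicator hA).toLp _, ((Lp.memLp f).indicator hA.compl).toLp _, ?_,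
    MemLp.coeFn_toLp _, MemLp.coeFn_toLp _⟩
  rw [← MemLp.toLp_add]
  conv_lhs => rw [← Lp.toLp_coeFn f (Lp.memLp f)]
  congr 1
  exact (Set.indicator_self_add_compl A f).symm

theorem IsBoundedCompactlySupported.of_norm_le {d : ℕ} {X : Type*} [NormedAddCommGroup X]
    {Ω : Set (EuclideanSpace ℝ (Fin d))} {f g : EuclideanSpace ℝ (Fin d) → X}
    (hf : IsBoundedCompactlySupported Ω f) (hg : AEStronglyMeasurable g (volume.restrict Ω))
    (hgf : ∀ᵐ x ∂(volume.restrict Ω), ‖g x‖ ≤ ‖f x‖) : IsBoundedCompactlySupported Ω g := by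
  obtain ⟨hf1, K, hK, hKΩ, hfK⟩ := hf
  refine ⟨hf1.mono hg hgf, K, hK, hKΩ, ?_⟩
  filter_upwards [hfK, hgf] with x h1 h2 hxK
  rw [h1 hxK, norm_zero] at h2
  exact norm_le_zero_iff.1 h2

/-- The constant in front of the squared threshold `ε ^ 2` in the estimate on one stopping ball.
For a stopping ball of radius `r`, the admissible ball around the sixfold ball has radius at most
`6 (α₂ + 1) r`, and its dilate by `α₂` lies in the concentric ball of radius
`(α₂ + 1) (6 (α₂ + 1)) r`. -/
noncomputable def nearConst (d : ℕ) (α₂ M : ℝ) : ℝ≥0∞ :=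
  4 * (ENNReal.ofReal M ^ (2 : ℝ) * ENNReal.ofReal ((α₂ + 1) * (6 * (α₂ + 1))) ^ d)

/-- The bound for the normalised `L ^ p` mean of the far part on a stopping ball. -/
noncomputable def reverseHolderConst (d : ℕ) (α₂ C : ℝ) : ℝ≥0∞ :=
  ENNReal.ofReal C *
    ((4 * (ENNReal.ofReal ((α₂ + 1) * (6 * (α₂ + 1))) ^ d *
      volume (closedBall (0 : EuclideanSpace ℝ (Fin d)) 1))) ^ (1 / 2 : ℝ) +
      ((2 : ℝ≥0∞) ^ d) ^ (1 / 2 : ℝ))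

/-- The constant in front of the power `H ^ (2 - p)` of the upper level in the estimate on one
stopping ball. -/
noncomputable def farConst (d : ℕ) (p α₂ C : ℝ) : ℝ≥0∞ :=
  4 * (reverseHolderConst d α₂ C ^ p *
    (ENNReal.ofReal (6 * (α₂ + 1)) ^ d / volume (closedBall (0 : EuclideanSpace ℝ (Fin d)) 1)))

set_option maxHeartbeats 1000000 in
/-- The estimate on one stopping ball: the part of `‖T f‖ ^ 2` above the level `H` is small if `H`
is large and the averages of `‖f‖ ^ 2` are small. The function is split into a near part, to which
the `L ^ 2` bound of `T` applies, and a far part, for which the weak reverse Hölder estimate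
yields an `L ^ p` bound. -/
theorem setLIntegral_closedBall_rpow_two_le {d : ℕ} (hd : 0 < d) {X Y : Type*}
    [NormedAddCommGroup X] [NormedSpace ℂ X] [NormedAddCommGroup Y] [NormedSpace ℂ Y]
    {Ω : Set (EuclideanSpace ℝ (Fin d))}
    {T : Lp X 2 (volume.restrict Ω) →L[ℂ] Lp Y 2 (volume.restrict Ω)}
    {p α₁ α₂ C M : ℝ} {R₀ : ℝ≥0∞} (hp : 2 < p) (hα₁ : 1 < α₁) (hα₂ : α₁ < α₂)
    (hT : ‖T‖ ≤ M) (hRH : WeakReverseHolder Ω T p α₁ α₂ C R₀)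
    {f : Lp X 2 (volume.restrict Ω)} (hf : IsBoundedCompactlySupported Ω f)
    {ε : ℝ≥0∞} (hε : ε ≤ 1) (hMε : ENNReal.ofReal M * ε ≤ 1)
    {x : EuclideanSpace ℝ (Fin d)} (hx : x ∈ Ω) {r : ℝ} (hr : 0 < r)
    (hrR₀ : ENNReal.ofReal (6 * (α₂ + 1) * r) < R₀)
    (hTf : ∀ ρ, 2 * r ≤ ρ → ∫⁻ y in closedBall x ρ, ‖T f y‖ₑ ^ (2 : ℝ) ∂(volume.restrict Ω) ≤
      volume (closedBall x ρ))
    (hff : ∀ ρ, 2 * r ≤ ρ → ∫⁻ y in closedBall x ρ, ‖f y‖ₑ ^ (2 : ℝ) ∂(volume.restrict Ω) ≤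
      ε ^ (2 : ℝ) * volume (closedBall x ρ)) (H : ℝ≥0∞) :
    ∫⁻ y in closedBall x (5 * r) ∩ {y | H < ‖T f y‖ₑ}, ‖T f y‖ₑ ^ (2 : ℝ) ∂(volume.restrict Ω) ≤
      (nearConst d α₂ M * ε ^ (2 : ℝ) + farConst d p α₂ C * (H / 2) ^ (2 - p)) *
        volume (closedBall x r) := by
  have : NeZero d := ⟨hd.ne'⟩
  set V := volume (closedBall x r) with hV
  set v := volume (closedBall (0 : EuclideanSpace ℝ (Fin d)) 1) with hv
  set κ : ℝ := 6 * (α₂ + 1) with hκ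
  set N : ℝ := (α₂ + 1) * κ with hN
  have hv0 : v ≠ 0 := (measure_closedBall_pos _ _ one_pos).ne'
  have hvt : v ≠ ∞ := measure_closedBall_lt_top.ne
  have hVv : V = ENNReal.ofReal r ^ d * v := by
    rw [hV, hv, ← volume_closedBall_mul x 0 hr.le zero_le_one, mul_one]
  obtain ⟨x₀, R, hadm, hR1, hR2, hsub, hdist⟩ :=
    exists_ball_frontier_or_subset hx (ρ := 6 * r) (α := α₂) (by positivity) (by linarith)
  have hR2 : R ≤ κ * r := by rw [hκ]; linarith
  have hR0 : 0 < R := by linarith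
  have hNr : (α₂ + 1) * R ≤ N * r := by
    rw [hN, mul_assoc]; exact mul_le_mul_of_nonneg_left hR2 (by linarith)
  have hin : ∀ α, α ≤ α₂ → ball x₀ (α * R) ⊆ closedBall x (N * r) := by
    intro α hα y hy
    rw [mem_closedBall]
    rw [mem_ball] at hy
    have := dist_triangle y x₀ x
    rw [dist_comm x₀ x] at this
    nlinarith
  have h2N : 2 * r ≤ N * r := by
    have : 2 ≤ N := by rw [hN, hκ]; nlinarith
    gcongr
  have hVN : volume (closedBall x (N * r)) = ENNReal.ofReal N ^ d * V :=
    volume_closedBall_mul x x (by rw [hN, hκ]; nlinarith) hr.le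
  obtain ⟨f₁, f₂, hfadd, hf₁, hf₂⟩ := exists_Lp_indicator_add f
    (measurableSet_ball (x := x₀) (ε := α₂ * R))
  -- The near part `f₁` is controlled by the stopping condition and the `L ^ 2` bound of `T`.
  have hf₁int : ∫⁻ y, ‖f₁ y‖ₑ ^ (2 : ℝ) ∂(volume.restrict Ω) ≤
      ε ^ (2 : ℝ) * (ENNReal.ofReal N ^ d * V) := by
    rw [← hVN]
    refine le_trans ?_ (hff (N * r) h2N)
    rw [← lintegral_indicator measurableSet_closedBall]
    refine lintegral_mono_ae ?_
    filter_upwards [hf₁] with y hy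
    rw [hy]
    by_cases hyB : y ∈ ball x₀ (α₂ * R)
    · rw [Set.indicator_of_mem hyB, Set.indicator_of_mem (hin α₂ le_rfl hyB)]
    · rw [Set.indicator_of_notMem hyB]; simp
  have hTf₁ : ∫⁻ y, ‖T f₁ y‖ₑ ^ (2 : ℝ) ∂(volume.restrict Ω) ≤
      ENNReal.ofReal M ^ (2 : ℝ) * (ε ^ (2 : ℝ) * (ENNReal.ofReal N ^ d * V)) :=
    (lintegral_enorm_clm_rpow_two_le T hT f₁).trans (by gcongr)
  have hTf₁' : ∫⁻ y, ‖T f₁ y‖ₑ ^ (2 : ℝ) ∂(volume.restrict Ω) ≤ ENNReal.ofReal N ^ d * V := by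
    refine hTf₁.trans ?_
    rw [← mul_assoc, ← ENNReal.mul_rpow_of_nonneg _ _ (by norm_num)]
    calc _ ≤ 1 * (ENNReal.ofReal N ^ d * V) := by
          gcongr; exact ENNReal.rpow_le_one hMε (by norm_num)
      _ = _ := one_mul _
  have hTadd : ∀ᵐ y ∂(volume.restrict Ω), T f y = T f₁ y + T f₂ y := by
    rw [hfadd, map_add]
    exact Lp.coeFn_add _ _
  -- The far part `f₂` vanishes on the dilated ball, so the weak reverse Hölder estimate applies.
  have hf₂le : ∀ᵐ y ∂(volume.restrict Ω), ‖f₂ y‖ ≤ ‖f y‖ := by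
    filter_upwards [hf₂] with y hy
    rw [hy]
    exact norm_indicator_le_norm_self _ _
  have hf₂b : IsBoundedCompactlySupported Ω f₂ :=
    hf.of_norm_le (Lp.aestronglyMeasurable f₂) hf₂le
  have hf₂0 : ∀ᵐ y ∂(volume.restrict (Ω ∩ ball x₀ (α₂ * R))), f₂ y = 0 := by
    rw [Set.inter_comm, ← Measure.restrict_restrict measurableSet_ball]
    filter_upwards [ae_restrict_of_ae hf₂, ae_restrict_mem measurableSet_ball] with y hy hyB
    rw [hy, Set.indicator_of_notMem (by simpa using hyB)]
  have hest := hRH x₀ R hR0 ((ENNReal.ofReal_le_ofReal hR2).trans_lt hrR₀) hadm f₂ hf₂b hf₂0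
  have hRd0 : ENNReal.ofReal (R ^ d) ≠ 0 := by
    simpa using pow_pos hR0 d
  have hRdt : ENNReal.ofReal (R ^ d) ≠ ∞ := ENNReal.ofReal_ne_top
  have hrR : ENNReal.ofReal r ^ d ≤ ENNReal.ofReal (R ^ d) := by
    rw [← ENNReal.ofReal_pow hr.le]
    exact ENNReal.ofReal_le_ofReal (pow_le_pow_left₀ hr.le (by linarith) d)
  have hmean : scaledLpMean Ω (T f₂) 2 R x₀ (α₁ * R) ≤
      (4 * (ENNReal.ofReal N ^ d * v)) ^ (1 / 2 : ℝ) := by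
    refine ENNReal.rpow_le_rpow ?_ (by norm_num)
    rw [ENNReal.div_le_iff hRd0 hRdt, Set.inter_comm,
      ← Measure.restrict_restrict measurableSet_ball]
    have hpt : ∀ᵐ y ∂(volume.restrict Ω), ‖T f₂ y‖ₑ ^ (2 : ℝ) ≤
        2 * ‖T f y‖ₑ ^ (2 : ℝ) + 2 * ‖T f₁ y‖ₑ ^ (2 : ℝ) := by
      filter_upwards [hTadd] with y hy
      have : T f₂ y = T f y - T f₁ y := by rw [hy]; abel
      rw [this]
      calc _ ≤ (‖T f y‖ₑ + ‖T f₁ y‖ₑ) ^ (2 : ℝ) :=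
            ENNReal.rpow_le_rpow enorm_sub_le (by norm_num)
        _ ≤ 2 ^ ((2 : ℝ) - 1) * (‖T f y‖ₑ ^ (2 : ℝ) + ‖T f₁ y‖ₑ ^ (2 : ℝ)) :=
            ENNReal.rpow_add_le_mul_rpow_add_rpow _ _ (by norm_num)
        _ = _ := by norm_num; ring
    calc ∫⁻ y in ball x₀ (α₁ * R), ‖T f₂ y‖ₑ ^ (2 : ℝ) ∂(volume.restrict Ω)
        ≤ ∫⁻ y in closedBall x (N * r), ‖T f₂ y‖ₑ ^ (2 : ℝ) ∂(volume.restrict Ω) :=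
          lintegral_mono_set (hin α₁ hα₂.le)
      _ ≤ ∫⁻ y in closedBall x (N * r), (2 * ‖T f y‖ₑ ^ (2 : ℝ) + 2 * ‖T f₁ y‖ₑ ^ (2 : ℝ))
            ∂(volume.restrict Ω) :=
          lintegral_mono_ae (ae_restrict_of_ae hpt)
      _ = 2 * ∫⁻ y in closedBall x (N * r), ‖T f y‖ₑ ^ (2 : ℝ) ∂(volume.restrict Ω) +
          2 * ∫⁻ y in closedBall x (N * r), ‖T f₁ y‖ₑ ^ (2 : ℝ) ∂(volume.restrict Ω) := by
          rw [lintegral_add_left' ?_, lintegral_const_mul' _ _ (by norm_num),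
            lintegral_const_mul' _ _ (by norm_num)]
          have := (Lp.stronglyMeasurable (T f)).enorm
          fun_prop
      _ ≤ 2 * (ENNReal.ofReal N ^ d * V) + 2 * (ENNReal.ofReal N ^ d * V) := by
          gcongr
          · rw [← hVN]; exact hTf (N * r) h2N
          · exact (setLIntegral_le_lintegral _ _).trans hTf₁'
      _ = 4 * (ENNReal.ofReal N ^ d * v) * ENNReal.ofReal r ^ d := by rw [hVv]; ring
      _ ≤ _ := by gcongr
  have hsup : supL2Average Ω f₂ x₀ R ≤ ((2 : ℝ≥0∞) ^ d) ^ (1 / 2 : ℝ) := by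
    refine iSup_le fun y => iSup_le fun ρ => iSup_le fun hρ => iSup_le fun hBρ => ?_
    refine ENNReal.rpow_le_rpow ?_ (by norm_num)
    have hvb : volume (ball y ρ) = volume (closedBall y ρ) :=
      (Measure.addHaar_closedBall_eq_addHaar_ball volume y ρ).symm
    have hxy : dist x y < ρ := mem_ball.1 (hBρ (mem_ball.2 hdist))
    -- A ball that contains another one has at least its volume, hence at least its radius.
    have hRρ : r ≤ ρ := by
      have h1 : volume (closedBall x₀ R) ≤ volume (closedBall y ρ) := by
        rw [← hvb, Measure.addHaar_closedBall_eq_addHaar_ball]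
        exact measure_mono hBρ
      by_contra! hlt
      have h2 : volume (closedBall y ρ) < volume (closedBall x₀ R) := by
        rw [Measure.addHaar_closedBall _ _ hρ.le, Measure.addHaar_closedBall _ _ hR0.le]
        refine (ENNReal.mul_lt_mul_iff_left (measure_ball_pos _ _ one_pos).ne'
          measure_ball_lt_top.ne).2 ?_
        rw [finrank_euclideanSpace_fin]
        exact (ENNReal.ofReal_lt_ofReal_iff (by positivity)).2
          (pow_lt_pow_left₀ (by linarith) hρ.le hd.ne')
      exact absurd h1 (not_le.2 h2)
    rw [hvb, ENNReal.div_le_iff (measure_closedBall_pos _ _ hρ).ne' measure_closedBall_lt_top.ne,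
      Set.inter_comm, ← Measure.restrict_restrict measurableSet_ball]
    -- The stopping condition concerns balls centred at `x`, which costs a factor two in the radius.
    have hsubρ : ball y ρ ⊆ closedBall x (2 * ρ) := by
      refine (ball_subset_ball' ?_).trans ball_subset_closedBall
      rw [dist_comm]; linarith
    calc ∫⁻ z in ball y ρ, ‖f₂ z‖ₑ ^ (2 : ℝ) ∂(volume.restrict Ω)
        ≤ ∫⁻ z in closedBall x (2 * ρ), ‖f₂ z‖ₑ ^ (2 : ℝ) ∂(volume.restrict Ω) :=
          lintegral_mono_set hsubρ
      _ ≤ ∫⁻ z in closedBall x (2 * ρ), ‖f z‖ₑ ^ (2 : ℝ) ∂(volume.restrict Ω) := by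
          refine lintegral_mono_ae (ae_restrict_of_ae ?_)
          filter_upwards [hf₂le] with z hz
          exact ENNReal.rpow_le_rpow (enorm_le_iff_norm_le.2 hz) (by norm_num)
      _ ≤ ε ^ (2 : ℝ) * volume (closedBall x (2 * ρ)) := hff _ (by linarith)
      _ ≤ 1 * volume (closedBall x (2 * ρ)) := by
          gcongr; exact ENNReal.rpow_le_one hε (by norm_num)
      _ = 2 ^ d * volume (closedBall y ρ) := by
          rw [one_mul, volume_closedBall_mul x y (by norm_num) hρ.le]; norm_num
  have hfar : ∫⁻ y in ball x₀ R, ‖T f₂ y‖ₑ ^ p ∂(volume.restrict Ω) ≤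
      reverseHolderConst d α₂ C ^ p * (ENNReal.ofReal κ ^ d * ENNReal.ofReal r ^ d) := by
    have h1 : scaledLpMean Ω (T f₂) p R x₀ R ≤ reverseHolderConst d α₂ C := by
      refine hest.trans ?_
      unfold reverseHolderConst
      gcongr
    unfold scaledLpMean at h1
    have h2 := ENNReal.rpow_le_rpow h1 (z := p) (by linarith)
    rw [← ENNReal.rpow_mul, one_div_mul_cancel (by linarith), ENNReal.rpow_one,
      ENNReal.div_le_iff hRd0 hRdt, Set.inter_comm,
      ← Measure.restrict_restrict measurableSet_ball] at h2
    refine h2.trans ?_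
    rw [← mul_pow, ← ENNReal.ofReal_mul (by rw [hκ]; linarith), ENNReal.ofReal_pow hR0.le]
    gcongr
  have hpt : ∀ᵐ y ∂(volume.restrict Ω), H < ‖T f y‖ₑ → ‖T f y‖ₑ ^ (2 : ℝ) ≤
      4 * ‖T f₁ y‖ₑ ^ (2 : ℝ) + 4 * ((H / 2) ^ (2 - p) * ‖T f₂ y‖ₑ ^ p) := by
    filter_upwards [hTadd] with y hy hH
    exact ENNReal.rpow_two_le_of_lt_of_le_add hp.le enorm_ne_top
      (by rw [hy]; exact enorm_add_le _ _) hH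
  have h5 : closedBall x (5 * r) ⊆ ball x₀ R :=
    (closedBall_subset_ball (by linarith)).trans hsub
  have hmeasH : MeasurableSet {y | H < ‖T f y‖ₑ} :=
    measurableSet_lt measurable_const (Lp.stronglyMeasurable (T f)).enorm
  have hcancel : ENNReal.ofReal κ ^ d * ENNReal.ofReal r ^ d = ENNReal.ofReal κ ^ d / v * V := by
    rw [hVv, mul_comm (ENNReal.ofReal r ^ d) v, ← mul_assoc, ENNReal.div_mul_cancel hv0 hvt]
  have hm₁ : AEMeasurable (fun y => 4 * ‖T f₁ y‖ₑ ^ (2 : ℝ))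
      ((volume.restrict Ω).restrict (ball x₀ R)) := by
    have := (Lp.stronglyMeasurable (T f₁)).enorm
    fun_prop
  have hm₂ : AEMeasurable (fun y => ‖T f₂ y‖ₑ ^ p)
      ((volume.restrict Ω).restrict (ball x₀ R)) := by
    have := (Lp.stronglyMeasurable (T f₂)).enorm
    fun_prop
  calc ∫⁻ y in closedBall x (5 * r) ∩ {y | H < ‖T f y‖ₑ}, ‖T f y‖ₑ ^ (2 : ℝ)
        ∂(volume.restrict Ω)
      ≤ ∫⁻ y in closedBall x (5 * r) ∩ {y | H < ‖T f y‖ₑ}, (4 * ‖T f₁ y‖ₑ ^ (2 : ℝ) +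
          4 * ((H / 2) ^ (2 - p) * ‖T f₂ y‖ₑ ^ p)) ∂(volume.restrict Ω) := by
        refine lintegral_mono_ae ?_
        filter_upwards [ae_restrict_of_ae hpt,
          ae_restrict_mem (measurableSet_closedBall.inter hmeasH)] with y hy hyH
        exact hy hyH.2
    _ ≤ ∫⁻ y in ball x₀ R, (4 * ‖T f₁ y‖ₑ ^ (2 : ℝ) +
          4 * ((H / 2) ^ (2 - p) * ‖T f₂ y‖ₑ ^ p)) ∂(volume.restrict Ω) :=
        lintegral_mono_set (Set.inter_subset_left.trans h5)
    _ = 4 * ∫⁻ y in ball x₀ R, ‖T f₁ y‖ₑ ^ (2 : ℝ) ∂(volume.restrict Ω) +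
          4 * ((H / 2) ^ (2 - p) * ∫⁻ y in ball x₀ R, ‖T f₂ y‖ₑ ^ p ∂(volume.restrict Ω)) := by
        rw [lintegral_add_left' hm₁, lintegral_const_mul' _ _ (by norm_num),
          lintegral_const_mul' _ _ (by norm_num), lintegral_const_mul'' _ hm₂]
    _ ≤ 4 * (ENNReal.ofReal M ^ (2 : ℝ) * (ε ^ (2 : ℝ) * (ENNReal.ofReal N ^ d * V))) +
          4 * ((H / 2) ^ (2 - p) * (reverseHolderConst d α₂ C ^ p *
            (ENNReal.ofReal κ ^ d / v * V))) := by
        gcongr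
        · exact (setLIntegral_le_lintegral _ _).trans hTf₁
        · rw [← hcancel]; exact hfar
    _ = _ := by
        rw [nearConst, farConst]
        ring

/-! ### The good-λ inequality -/

theorem nearConst_ne_top (d : ℕ) (α₂ M : ℝ) : nearConst d α₂ M ≠ ∞ := by
  unfold nearConst
  have h : ENNReal.ofReal M ^ (2 : ℝ) ≠ ∞ :=
    ENNReal.rpow_ne_top_of_nonneg (by norm_num) ENNReal.ofReal_ne_top
  exact ENNReal.mul_ne_top (by norm_num)
    (ENNReal.mul_ne_top h (ENNReal.pow_ne_top ENNReal.ofReal_ne_top))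

theorem farConst_ne_top (d : ℕ) {p α₂ C : ℝ} (hp : 0 ≤ p) : farConst d p α₂ C ≠ ∞ := by
  unfold farConst reverseHolderConst
  refine ENNReal.mul_ne_top (by norm_num) (ENNReal.mul_ne_top
    (ENNReal.rpow_ne_top_of_nonneg hp (ENNReal.mul_ne_top ENNReal.ofReal_ne_top
      (ENNReal.add_ne_top.2 ⟨ENNReal.rpow_ne_top_of_nonneg (by norm_num) ?_,
        ENNReal.rpow_ne_top_of_nonneg (by norm_num) (ENNReal.pow_ne_top (by norm_num))⟩)))
    (ENNReal.div_ne_top (ENNReal.pow_ne_top ENNReal.ofReal_ne_top)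
      (measure_closedBall_pos _ _ one_pos).ne'))
  exact ENNReal.mul_ne_top (by norm_num) (ENNReal.mul_ne_top
    (ENNReal.pow_ne_top ENNReal.ofReal_ne_top) measure_closedBall_lt_top.ne)

/-- The gain factor in the good-λ inequality for `‖T f‖`. -/
noncomputable def goodLambdaConst (d : ℕ) (p α₂ C M ε H : ℝ) : ℝ≥0∞ :=
  nearConst d α₂ M * ENNReal.ofReal ε ^ (2 : ℝ) +
    farConst d p α₂ C * (ENNReal.ofReal H / 2) ^ (2 - p)

theorem rpow_two_le_indicator_add {X : Type*} [NormedAddCommGroup X] (a : X) {t : ℝ}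
    (ht : 0 < t) :
    (ENNReal.ofReal t ^ (2 : ℝ))⁻¹ * ‖a‖ₑ ^ (2 : ℝ) ≤
      (ENNReal.ofReal t ^ (2 : ℝ))⁻¹ * {b : X | t / 2 < ‖b‖}.indicator (fun b => ‖b‖ₑ ^ (2 : ℝ)) a
        + 1 / 4 := by
  by_cases h : t / 2 < ‖a‖
  · rw [Set.indicator_of_mem (by exact h)]
    exact le_self_add
  · refine le_add_left ?_
    have h1 : ‖a‖ₑ ≤ ENNReal.ofReal t * ENNReal.ofReal (1 / 2) := by
      rw [← ENNReal.ofReal_mul ht.le, ← ofReal_norm]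
      exact ENNReal.ofReal_le_ofReal (by linarith [not_lt.1 h])
    have h0 : ENNReal.ofReal t ^ (2 : ℝ) ≠ 0 := by
      simp [ht]
    have ht' : ENNReal.ofReal t ^ (2 : ℝ) ≠ ∞ :=
      ENNReal.rpow_ne_top_of_nonneg (by norm_num) ENNReal.ofReal_ne_top
    calc _ ≤ (ENNReal.ofReal t ^ (2 : ℝ))⁻¹ *
          (ENNReal.ofReal t * ENNReal.ofReal (1 / 2)) ^ (2 : ℝ) := by gcongr
      _ = ENNReal.ofReal (1 / 2) ^ (2 : ℝ) := by
        rw [ENNReal.mul_rpow_of_nonneg _ _ (by norm_num), ← mul_assoc,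
          ENNReal.inv_mul_cancel h0 ht', one_mul]
      _ = 1 / 4 := by
        rw [ENNReal.ofReal_rpow_of_pos (by norm_num), show ((1 : ℝ) / 2) ^ (2 : ℝ) = 1 / 4 by
          rw [Real.rpow_two]; norm_num, ENNReal.ofReal_div_of_pos (by norm_num)]
        simp

section GoodLambda

variable {d : ℕ} {X Y : Type*}
  [NormedAddCommGroup X] [NormedSpace ℂ X] [NormedAddCommGroup Y] [NormedSpace ℂ Y]
  {Ω : Set (EuclideanSpace ℝ (Fin d))}
  {T : Lp X 2 (volume.restrict Ω) →L[ℂ] Lp Y 2 (volume.restrict Ω)}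
  {p α₁ α₂ C M : ℝ} {R₀ : ℝ≥0∞} {f : Lp X 2 (volume.restrict Ω)} {ε H : ℝ}

set_option maxHeartbeats 1000000 in
/-- The good-λ inequality at level one. The stopping balls of `‖T f‖ ^ 2 + ‖f‖ ^ 2 / ε ^ 2` have
radius less than `r₀`, so that the weak reverse Hölder estimate is available on them. -/
theorem setLIntegral_lt_norm_le_of_level_one (hd : 0 < d) (hΩ : NullMeasurableSet Ω volume)
    (hp : 2 < p) (hα₁ : 1 < α₁) (hα₂ : α₁ < α₂)
    (hT : ‖T‖ ≤ M) (hRH : WeakReverseHolder Ω T p α₁ α₂ C R₀)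
    (hf : IsBoundedCompactlySupported Ω f) (hε0 : 0 < ε) (hε : ε ≤ 1) (hMε : M * ε ≤ 1)
    (hH : 1 ≤ H) {r₀ : ℝ} (hr₀ : ENNReal.ofReal (6 * (α₂ + 1) * r₀) ≤ R₀)
    (hsmall : ∫⁻ y, ‖T f y‖ₑ ^ (2 : ℝ) ∂(volume.restrict Ω) + (ENNReal.ofReal ε ^ (2 : ℝ))⁻¹ *
      ∫⁻ y, ‖f y‖ₑ ^ (2 : ℝ) ∂(volume.restrict Ω) <
        volume (closedBall (0 : EuclideanSpace ℝ (Fin d)) r₀)) :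
    ∫⁻ y in {y | H < ‖T f y‖}, ‖T f y‖ₑ ^ (2 : ℝ) ∂(volume.restrict Ω) ≤
      2 * goodLambdaConst d p α₂ C M ε H *
        (∫⁻ y in {y | 1 / 2 < ‖T f y‖}, ‖T f y‖ₑ ^ (2 : ℝ) ∂(volume.restrict Ω) +
          (ENNReal.ofReal ε ^ (2 : ℝ))⁻¹ *
            ∫⁻ y in {y | ε / 2 < ‖f y‖}, ‖f y‖ₑ ^ (2 : ℝ) ∂(volume.restrict Ω)) := by
  have : NeZero d := ⟨hd.ne'⟩
  set e := (ENNReal.ofReal ε ^ (2 : ℝ))⁻¹ with he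
  have he0 : ENNReal.ofReal ε ^ (2 : ℝ) ≠ 0 := by simp [hε0]
  have het : ENNReal.ofReal ε ^ (2 : ℝ) ≠ ∞ :=
    ENNReal.rpow_ne_top_of_nonneg (by norm_num) ENNReal.ofReal_ne_top
  have het' : e ≠ ∞ := ENNReal.inv_ne_top.2 he0
  have hTm : Measurable fun y => ‖T f y‖ₑ ^ (2 : ℝ) := by
    have := (Lp.stronglyMeasurable (T f)).enorm
    fun_prop
  have hfm : Measurable fun y => ‖f y‖ₑ ^ (2 : ℝ) := by
    have := (Lp.stronglyMeasurable f).enorm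
    fun_prop
  have hSm : ∀ t : ℝ, MeasurableSet {y | t < ‖T f y‖} := fun t =>
    measurableSet_lt measurable_const (Lp.stronglyMeasurable (T f)).norm.measurable
  have hSfm : ∀ t : ℝ, MeasurableSet {y | t < ‖f y‖} := fun t =>
    measurableSet_lt measurable_const (Lp.stronglyMeasurable f).norm.measurable
  set g : EuclideanSpace ℝ (Fin d) → ℝ≥0∞ := fun y => ‖T f y‖ₑ ^ (2 : ℝ) + e * ‖f y‖ₑ ^ (2 : ℝ)
    with hg
  have hgm : Measurable g := hTm.add (hfm.const_mul e)
  set G := Ω.indicator g with hG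
  set g₁ : EuclideanSpace ℝ (Fin d) → ℝ≥0∞ := fun y =>
    {y | 1 / 2 < ‖T f y‖}.indicator (fun y => ‖T f y‖ₑ ^ (2 : ℝ)) y +
      e * {y | ε / 2 < ‖f y‖}.indicator (fun y => ‖f y‖ₑ ^ (2 : ℝ)) y with hg₁
  have hGint : ∀ ρ x, ∫⁻ y in closedBall x ρ, G y =
      ∫⁻ y in closedBall x ρ, g y ∂(volume.restrict Ω) := fun ρ x => by
    rw [hG, lintegral_indicator₀ (hΩ.mono_ac Measure.restrict_le_self.absolutelyContinuous),
      Measure.restrict_restrict measurableSet_closedBall, Measure.restrict_restrict₀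
        (hΩ.mono_ac Measure.restrict_le_self.absolutelyContinuous), Set.inter_comm]
  have hGuniv : ∫⁻ y, G y < volume (closedBall (0 : EuclideanSpace ℝ (Fin d)) r₀) := by
    rw [hG, lintegral_indicator₀ hΩ, hg, lintegral_add_left hTm, lintegral_const_mul e hfm]
    exact hsmall
  have hGG₁ : ∀ x, G x ≤ Ω.indicator g₁ x + 1 / 2 := by
    intro x
    by_cases hx : x ∈ Ω
    · rw [hG, Set.indicator_of_mem hx, Set.indicator_of_mem hx]
      have h1 := rpow_two_le_indicator_add (T f x) one_pos
      have h2 := rpow_two_le_indicator_add (f x) hε0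
      simp only [ENNReal.ofReal_one, ENNReal.one_rpow, inv_one, one_mul] at h1
      have h4 : (1 : ℝ≥0∞) / 4 + 1 / 4 = 1 / 2 := by
        rw [ENNReal.div_add_div_same, ENNReal.div_eq_div_iff] <;> norm_num
      calc g x ≤ _ := add_le_add h1 h2
        _ = g₁ x + (1 / 4 + 1 / 4) := by
          simp only [hg₁]
          simp only [Set.indicator_apply, Set.mem_ofPred_eq]
          ring
        _ = _ := by rw [h4]
    · rw [hG, Set.indicator_of_notMem hx]; simp
  set S := {y | H < ‖T f y‖} with hS
  -- The covering argument is applied to the measure with density `‖T f‖ ^ 2` on `{H < ‖T f‖}`.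
  set ν := ((volume.restrict Ω).restrict S).withDensity fun y => ‖T f y‖ₑ ^ (2 : ℝ) with hν
  have hνμ : ν ≪ (volume.restrict Ω).restrict S := withDensity_absolutelyContinuous _ _
  have hνa : ∀ A, MeasurableSet A →
      ν A = ∫⁻ y in A ∩ S, ‖T f y‖ₑ ^ (2 : ℝ) ∂(volume.restrict Ω) := fun A hA => by
    rw [hν, withDensity_apply _ hA, Measure.restrict_restrict hA]
  have hmem : ∀ᵐ x ∂ν, x ∈ Ω ∧ x ∈ S := hνμ.ae_le
    ((ae_restrict_of_ae (ae_restrict_mem₀ hΩ)).and (ae_restrict_mem (hSm H)))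
  have hmain := measure_univ_le_of_isStoppingRadius volume (G := G) (G₁ := Ω.indicator g₁)
    (hgm.aemeasurable.indicator₀ hΩ) (hGuniv.trans measure_closedBall_lt_top).ne hGG₁
    (ν := ν) (hνμ.trans (Measure.restrict_le_self.absolutelyContinuous.trans
      Measure.restrict_le_self.absolutelyContinuous))
    (η := goodLambdaConst d p α₂ C M ε H) ?_
  · rw [hνa _ MeasurableSet.univ, Set.univ_inter, lintegral_indicator₀ hΩ] at hmain
    refine hmain.trans_eq ?_
    rw [hg₁, lintegral_add_left (hTm.indicator (hSm _)), lintegral_indicator (hSm _),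
      lintegral_const_mul e (hfm.indicator (hSfm _)), lintegral_indicator (hSfm _)]
  · filter_upwards [hmem] with x hx
    have hTx : 1 < ‖T f x‖ₑ := by
      rw [← ofReal_norm, ENNReal.one_lt_ofReal]
      exact lt_of_le_of_lt hH hx.2
    refine ⟨?_, fun r hr => ?_⟩
    · rw [hG, Set.indicator_of_mem hx.1]
      exact (ENNReal.one_lt_rpow hTx (by norm_num)).trans_le le_self_add
    · have hrlt := hr.lt volume hGuniv
      have hr₀0 : 0 < r₀ := hr.1.trans hrlt
      have hκ : 0 < 6 * (α₂ + 1) := by linarith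
      have hset : {y | ENNReal.ofReal H < ‖T f y‖ₑ} = S := by
        ext y
        simp only [hS, Set.mem_ofPred_eq]
        rw [← ofReal_norm, ENNReal.ofReal_lt_ofReal_iff_of_nonneg (by linarith)]
      have hloc := setLIntegral_closedBall_rpow_two_le hd hp hα₁ hα₂ hT hRH hf
        (ε := ENNReal.ofReal ε) (ENNReal.ofReal_le_one.2 hε)
        (by rw [← ENNReal.ofReal_mul' hε0.le]; exact ENNReal.ofReal_le_one.2 hMε) hx.1 hr.1
        (lt_of_lt_of_le ((ENNReal.ofReal_lt_ofReal_iff (by positivity)).2 (by gcongr)) hr₀)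
        (fun ρ hρ => ?_) (fun ρ hρ => ?_) (ENNReal.ofReal H)
      · rw [hset] at hloc
        rw [hνa _ measurableSet_closedBall]
        exact hloc
      · refine le_trans ?_ (hr.2.2 ρ hρ)
        rw [hGint]
        exact lintegral_mono fun y => le_self_add
      · have := hr.2.2 ρ hρ
        rw [hGint] at this
        have h3 : e * ∫⁻ y in closedBall x ρ, ‖f y‖ₑ ^ (2 : ℝ) ∂(volume.restrict Ω) ≤
            volume (closedBall x ρ) := by
          rw [← lintegral_const_mul e hfm]
          exact (lintegral_mono fun y => le_add_self).trans this
        rw [he, mul_comm, ← div_eq_mul_inv, ENNReal.div_le_iff he0 het, mul_comm] at h3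
        exact h3

theorem setOf_neg_lt_norm {α Z : Type*} [NormedAddCommGroup Z] (u : α → Z) {t : ℝ} (ht : t < 0) :
    {x | t < ‖u x‖} = Set.univ :=
  Set.eq_univ_of_forall fun _ => lt_of_lt_of_le ht (norm_nonneg _)

theorem enorm_rpow_two_mul_ofReal_rpow {Z : Type*} [NormedAddCommGroup Z] (z : Z) {t q : ℝ}
    (ht : 0 < t) (hq : 2 ≤ q) : ‖z‖ₑ ^ (2 : ℝ) * ENNReal.ofReal ((t * ‖z‖) ^ (q - 2)) =
      ENNReal.ofReal (t ^ (q - 2)) * ‖z‖ₑ ^ q := by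
  have ha : 0 ≤ q - 2 := by linarith
  rw [Real.mul_rpow ht.le (norm_nonneg _), ENNReal.ofReal_mul (by positivity),
    ← ENNReal.ofReal_rpow_of_nonneg (norm_nonneg z) ha, ofReal_norm, mul_left_comm,
    ← ENNReal.rpow_add_of_nonneg _ _ (by norm_num) ha]
  congr 2; ring

theorem setLIntegral_lt_norm_of_ae_eq_smul {α Z : Type*} [MeasurableSpace α] {μ : Measure α}
    [NormedAddCommGroup Z] [NormedSpace ℂ Z] {u v : α → Z} {s : ℝ} (hs : 0 < s)
    (hu : StronglyMeasurable u) (hv : StronglyMeasurable v)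
    (h : v =ᵐ[μ] ((s⁻¹ : ℝ) : ℂ) • u) (t : ℝ) :
    ∫⁻ x in {x | t < ‖v x‖}, ‖v x‖ₑ ^ (2 : ℝ) ∂μ =
      ENNReal.ofReal s⁻¹ ^ (2 : ℝ) * ∫⁻ x in {x | t * s < ‖u x‖}, ‖u x‖ₑ ^ (2 : ℝ) ∂μ := by
  rw [← lintegral_indicator (measurableSet_lt measurable_const hv.norm.measurable),
    ← lintegral_indicator (measurableSet_lt measurable_const hu.norm.measurable),
    ← lintegral_const_mul' _ _
      (ENNReal.rpow_ne_top_of_nonneg (by norm_num) ENNReal.ofReal_ne_top)]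
  refine lintegral_congr_ae ?_
  filter_upwards [h] with x hx
  have hn : ‖v x‖ = s⁻¹ * ‖u x‖ := by
    rw [hx, Pi.smul_apply, norm_smul, Complex.norm_real, Real.norm_of_nonneg (by positivity)]
  have hiff : t < ‖v x‖ ↔ t * s < ‖u x‖ := by
    rw [hn, inv_mul_eq_div, lt_div_iff₀ hs]
  by_cases hm : t < ‖v x‖
  · rw [Set.indicator_of_mem (by exact hm), Set.indicator_of_mem (by exact hiff.1 hm),
      ← ofReal_norm, hn, ENNReal.ofReal_mul (by positivity),
      ENNReal.mul_rpow_of_nonneg _ _ (by norm_num), ofReal_norm]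
  · have hm' : x ∉ {x | t * s < ‖u x‖} := mt hiff.2 hm
    rw [Set.indicator_of_notMem (by exact hm), Set.indicator_of_notMem hm', mul_zero]

/-- The good-λ inequality at the level `s`, obtained from level one by homogeneity. -/
theorem setLIntegral_lt_norm_le (hd : 0 < d) (hΩ : NullMeasurableSet Ω volume)
    (hp : 2 < p) (hα₁ : 1 < α₁) (hα₂ : α₁ < α₂)
    (hT : ‖T‖ ≤ M) (hRH : WeakReverseHolder Ω T p α₁ α₂ C R₀)
    (hf : IsBoundedCompactlySupported Ω f) (hε0 : 0 < ε) (hε : ε ≤ 1) (hMε : M * ε ≤ 1)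
    (hH : 1 ≤ H) {r₀ : ℝ} (hr₀ : ENNReal.ofReal (6 * (α₂ + 1) * r₀) ≤ R₀) {s : ℝ} (hs : 0 < s)
    (hsmall : ∫⁻ y, ‖T f y‖ₑ ^ (2 : ℝ) ∂(volume.restrict Ω) + (ENNReal.ofReal ε ^ (2 : ℝ))⁻¹ *
      ∫⁻ y, ‖f y‖ₑ ^ (2 : ℝ) ∂(volume.restrict Ω) <
        ENNReal.ofReal s ^ (2 : ℝ) * volume (closedBall (0 : EuclideanSpace ℝ (Fin d)) r₀)) :
    ∫⁻ y in {y | H * s < ‖T f y‖}, ‖T f y‖ₑ ^ (2 : ℝ) ∂(volume.restrict Ω) ≤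
      2 * goodLambdaConst d p α₂ C M ε H *
        (∫⁻ y in {y | 1 / 2 * s < ‖T f y‖}, ‖T f y‖ₑ ^ (2 : ℝ) ∂(volume.restrict Ω) +
          (ENNReal.ofReal ε ^ (2 : ℝ))⁻¹ *
            ∫⁻ y in {y | ε / 2 * s < ‖f y‖}, ‖f y‖ₑ ^ (2 : ℝ) ∂(volume.restrict Ω)) := by
  set c : ℂ := ((s⁻¹ : ℝ) : ℂ) with hc
  set k := ENNReal.ofReal s⁻¹ ^ (2 : ℝ) with hk
  have hk0 : k ≠ 0 := by simp [hk, hs]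
  have hkt : k ≠ ∞ := ENNReal.rpow_ne_top_of_nonneg (by norm_num) ENNReal.ofReal_ne_top
  have hks : k * ENNReal.ofReal s ^ (2 : ℝ) = 1 := by
    rw [hk, ← ENNReal.mul_rpow_of_nonneg _ _ (by norm_num), ← ENNReal.ofReal_mul (by positivity),
      inv_mul_cancel₀ hs.ne']
    simp
  have hcf : (c • f : Lp X 2 (volume.restrict Ω)) =ᵐ[volume.restrict Ω] c • ⇑f :=
    Lp.coeFn_smul c f
  have hcT : T (c • f) =ᵐ[volume.restrict Ω] c • ⇑(T f) := by
    rw [map_smul]; exact Lp.coeFn_smul c (T f)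
  have eT := setLIntegral_lt_norm_of_ae_eq_smul hs (Lp.stronglyMeasurable (T f))
    (Lp.stronglyMeasurable (T (c • f))) hcT
  have ef := setLIntegral_lt_norm_of_ae_eq_smul hs (Lp.stronglyMeasurable f)
    (Lp.stronglyMeasurable (c • f)) hcf
  -- The level `-1` turns the restricted integrals into integrals over the whole space.
  have eT' := eT (-1)
  have ef' := ef (-1)
  rw [setOf_neg_lt_norm _ (by norm_num), setOf_neg_lt_norm _ (by linarith)] at eT' ef'
  simp only [Measure.restrict_univ] at eT' ef'
  have hbf : IsBoundedCompactlySupported Ω (c • f : Lp X 2 (volume.restrict Ω)) := by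
    obtain ⟨h1, K, hK, hKΩ, h2⟩ := hf
    refine ⟨(h1.const_smul c).ae_eq hcf.symm, K, hK, hKΩ, ?_⟩
    filter_upwards [h2, hcf] with x hx hx' hxK
    rw [hx', Pi.smul_apply, hx hxK, smul_zero]
  have h := setLIntegral_lt_norm_le_of_level_one hd hΩ hp hα₁ hα₂ hT hRH hbf hε0 hε hMε hH hr₀
    (by
      rw [eT', ef']
      calc _ = k * (∫⁻ y, ‖T f y‖ₑ ^ (2 : ℝ) ∂(volume.restrict Ω) +
            (ENNReal.ofReal ε ^ (2 : ℝ))⁻¹ * ∫⁻ y, ‖f y‖ₑ ^ (2 : ℝ) ∂(volume.restrict Ω)) := by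
            ring
        _ < k * (ENNReal.ofReal s ^ (2 : ℝ) *
            volume (closedBall (0 : EuclideanSpace ℝ (Fin d)) r₀)) :=
            (ENNReal.mul_lt_mul_iff_right hk0 hkt).2 hsmall
        _ = _ := by rw [← mul_assoc, hks, one_mul])
  rw [eT, eT, ef] at h
  rw [← ENNReal.mul_le_mul_iff_right hk0 hkt]
  exact h.trans_eq (by ring)

/-- The bound for `∫ ‖T f‖ ^ q` that follows from the good-λ inequality at all levels `s ≥ σ`. -/
theorem lintegral_enorm_rpow_le_of_goodLambda (hd : 0 < d) (hΩ : NullMeasurableSet Ω volume)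
    (hp : 2 < p) (hα₁ : 1 < α₁) (hα₂ : α₁ < α₂)
    (hT : ‖T‖ ≤ M) (hRH : WeakReverseHolder Ω T p α₁ α₂ C R₀)
    (hf : IsBoundedCompactlySupported Ω f) (hε0 : 0 < ε) (hε : ε ≤ 1) (hMε : M * ε ≤ 1)
    (hH : 1 ≤ H) {q : ℝ} (hq : 2 < q)
    (hη : 2 * goodLambdaConst d p α₂ C M ε H * ENNReal.ofReal ((2 * H) ^ (q - 2)) ≤ 1 / 2)
    {σ : ℝ} (hσ : 0 ≤ σ)
    (hlevel : ∀ s, 0 < s → σ ≤ s → ∃ r₀ : ℝ, ENNReal.ofReal (6 * (α₂ + 1) * r₀) ≤ R₀ ∧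
      ∫⁻ y, ‖T f y‖ₑ ^ (2 : ℝ) ∂(volume.restrict Ω) + (ENNReal.ofReal ε ^ (2 : ℝ))⁻¹ *
      ∫⁻ y, ‖f y‖ₑ ^ (2 : ℝ) ∂(volume.restrict Ω) <
        ENNReal.ofReal s ^ (2 : ℝ) * volume (closedBall (0 : EuclideanSpace ℝ (Fin d)) r₀)) :
    ∫⁻ y, ‖T f y‖ₑ ^ q ∂(volume.restrict Ω) ≤
      ENNReal.ofReal (H ^ (q - 2)) * (2 *
        (ENNReal.ofReal (σ ^ (q - 2)) * ∫⁻ y, ‖T f y‖ₑ ^ (2 : ℝ) ∂(volume.restrict Ω) +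
          (ENNReal.ofReal ε ^ (2 : ℝ))⁻¹ * ENNReal.ofReal ((2 / ε) ^ (q - 2)) *
            ∫⁻ y, ‖f y‖ₑ ^ q ∂(volume.restrict Ω))) := by
  have hH0 : 0 < H := by linarith
  have ha : 0 < q - 2 := by linarith
  set e := (ENNReal.ofReal ε ^ (2 : ℝ))⁻¹ with he
  have het' : e ≠ ∞ := ENNReal.inv_ne_top.2 (by simp [hε0])
  have hTm : Measurable fun y => ‖T f y‖ₑ ^ (2 : ℝ) := by
    have := (Lp.stronglyMeasurable (T f)).enorm
    fun_prop
  have hfm : Measurable fun y => ‖f y‖ₑ ^ (2 : ℝ) := by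
    have := (Lp.stronglyMeasurable f).enorm
    fun_prop
  have hTn : Measurable fun y => ‖T f y‖ := (Lp.stronglyMeasurable (T f)).norm.measurable
  have hfn : Measurable fun y => ‖f y‖ := (Lp.stronglyMeasurable f).norm.measurable
  set μT := (volume.restrict Ω).withDensity fun y => ‖T f y‖ₑ ^ (2 : ℝ) with hμT
  set μf := (volume.restrict Ω).withDensity fun y => ‖f y‖ₑ ^ (2 : ℝ) with hμf
  have hfin : IsFiniteMeasure μT := isFiniteMeasure_withDensity (lintegral_enorm_rpow_two_ne_top _)
  have hη2 : 2 * goodLambdaConst d p α₂ C M ε H ≤ 1 := by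
    have h1 : (1 : ℝ≥0∞) ≤ ENNReal.ofReal ((2 * H) ^ (q - 2)) :=
      ENNReal.one_le_ofReal.2 (Real.one_le_rpow (by linarith) ha.le)
    calc _ ≤ 2 * goodLambdaConst d p α₂ C M ε H * ENNReal.ofReal ((2 * H) ^ (q - 2)) :=
          le_mul_of_one_le_right' h1
      _ ≤ 1 / 2 := hη
      _ ≤ 1 := by norm_num
  have key := lintegral_rpow_le_of_goodLambda μT (e • μf) (v := fun y => H⁻¹ * ‖T f y‖)
    (w := fun y => 2 / ε * ‖f y‖) (fun y => by positivity) (fun y => by positivity)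
    (hTn.const_mul _).aemeasurable (hfn.const_mul _).aemeasurable ha (b := 2 * H) (by linarith) hσ
    (η := 2 * goodLambdaConst d p α₂ C M ε H) (ne_top_of_le_ne_top (by norm_num) hη2) hη ?_
  · rw [lintegral_withDensity_eq_lintegral_mul _ hTm (by fun_prop), lintegral_smul_measure,
      lintegral_withDensity_eq_lintegral_mul _ hfm (by fun_prop), hμT,
      withDensity_apply _ MeasurableSet.univ, Measure.restrict_univ] at key
    -- The density raises the exponent by two.
    simp only [Pi.mul_apply, enorm_rpow_two_mul_ofReal_rpow _ (inv_pos.2 hH0) hq.le,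
      enorm_rpow_two_mul_ofReal_rpow _ (div_pos two_pos hε0) hq.le] at key
    rw [lintegral_const_mul' _ _ ENNReal.ofReal_ne_top,
      lintegral_const_mul' _ _ ENNReal.ofReal_ne_top] at key
    have hcancel : ENNReal.ofReal (H ^ (q - 2)) * ENNReal.ofReal (H⁻¹ ^ (q - 2)) = 1 := by
      rw [← ENNReal.ofReal_mul (by positivity), ← Real.mul_rpow hH0.le (by positivity),
        mul_inv_cancel₀ hH0.ne', Real.one_rpow, ENNReal.ofReal_one]
    calc ∫⁻ y, ‖T f y‖ₑ ^ q ∂(volume.restrict Ω)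
        = ENNReal.ofReal (H ^ (q - 2)) * (ENNReal.ofReal (H⁻¹ ^ (q - 2)) *
          ∫⁻ y, ‖T f y‖ₑ ^ q ∂(volume.restrict Ω)) := by rw [← mul_assoc, hcancel, one_mul]
      _ ≤ _ := by
        refine mul_le_mul_right (key.trans
          (mul_le_mul_right (add_le_add_right (le_trans ?_ (one_mul _).le) _) _)) _
        rw [mul_assoc e, smul_eq_mul]
        exact mul_le_mul_left hη2 _
  · intro s hs hσs
    obtain ⟨r₀, hr₀, hsmall⟩ := hlevel s hs hσs
    have h := setLIntegral_lt_norm_le hd hΩ hp hα₁ hα₂ hT hRH hf hε0 hε hMε hH hr₀ hs hsmall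
    have hs1 : {y | s < H⁻¹ * ‖T f y‖} = {y | H * s < ‖T f y‖} := by
      ext y
      change s < H⁻¹ * ‖T f y‖ ↔ H * s < ‖T f y‖
      rw [inv_mul_eq_div, lt_div_iff₀' hH0]
    have hs2 : {y | s < 2 * H * (H⁻¹ * ‖T f y‖)} = {y | 1 / 2 * s < ‖T f y‖} := by
      ext y
      change s < 2 * H * (H⁻¹ * ‖T f y‖) ↔ 1 / 2 * s < ‖T f y‖
      rw [mul_assoc, mul_inv_cancel_left₀ hH0.ne']
      constructor <;> intro h <;> linarith
    have hs3 : {y | s < 2 / ε * ‖f y‖} = {y | ε / 2 * s < ‖f y‖} := by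
      ext y
      change s < 2 / ε * ‖f y‖ ↔ ε / 2 * s < ‖f y‖
      rw [div_mul_eq_mul_div, div_mul_eq_mul_div, lt_div_iff₀ hε0, div_lt_iff₀ two_pos]
      constructor <;> intro h <;> linarith
    rw [hs1, hs2, hs3, Measure.smul_apply, smul_eq_mul, hμT, hμf,
      withDensity_apply _ (measurableSet_lt measurable_const hTn),
      withDensity_apply _ (measurableSet_lt measurable_const hTn),
      withDensity_apply _ (measurableSet_lt measurable_const hfn)]
    exact h

end GoodLambda

/-! ### The bound for bounded compactly supported functions -/

/-- The level `H` and the threshold `ε` can be chosen such that the good-λ inequality can be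
absorbed in `L ^ q`: this is where `q < p` enters, through the decay of `H ^ (q - p)`. -/
theorem exists_goodLambdaConst_mul_le (d : ℕ) {p q : ℝ} (α₂ C M : ℝ) (hq : 2 < q) (hqp : q < p) :
    ∃ ε H : ℝ, 0 < ε ∧ ε ≤ 1 ∧ M * ε ≤ 1 ∧ 1 ≤ H ∧
      2 * goodLambdaConst d p α₂ C M ε H * ENNReal.ofReal ((2 * H) ^ (q - 2)) ≤ 1 / 2 := by
  set k₁ := (nearConst d α₂ M).toNNReal
  set k₂ := (farConst d p α₂ C).toNNReal
  have hk₁ : (k₁ : ℝ≥0∞) = nearConst d α₂ M := ENNReal.coe_toNNReal (nearConst_ne_top d α₂ M)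
  have hk₂ : (k₂ : ℝ≥0∞) = farConst d p α₂ C :=
    ENNReal.coe_toNNReal (farConst_ne_top d (by linarith))
  have hH : Filter.Tendsto (fun H : ℝ => 2 * (k₂ : ℝ) * (2 ^ (p - 2) * 2 ^ (q - 2)) *
      H ^ (-(p - q))) Filter.atTop (nhds 0) := by
    simpa using (tendsto_rpow_neg_atTop (sub_pos.2 hqp)).const_mul
      (2 * (k₂ : ℝ) * (2 ^ (p - 2) * 2 ^ (q - 2)))
  obtain ⟨H, hH1, hH2⟩ := ((hH.eventually (gt_mem_nhds (show (0 : ℝ) < 1 / 4 by norm_num))).and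
    (Filter.eventually_ge_atTop 1)).exists
  have hH0 : 0 < H := by linarith
  have h1 : Filter.Tendsto (fun ε : ℝ => 2 * (k₁ : ℝ) * (2 * H) ^ (q - 2) * ε ^ 2)
      (nhds 0) (nhds 0) := by
    have : Continuous fun ε : ℝ => 2 * (k₁ : ℝ) * (2 * H) ^ (q - 2) * ε ^ 2 := by fun_prop
    simpa using this.tendsto 0
  have h2 : Filter.Tendsto (fun ε : ℝ => M * ε) (nhds 0) (nhds 0) := by
    have : Continuous fun ε : ℝ => M * ε := by fun_prop
    simpa using this.tendsto 0
  obtain ⟨ε, ⟨⟨hε1, hε2⟩, hε3⟩, hε0⟩ := ((((h1.eventually (gt_mem_nhds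
    (show (0 : ℝ) < 1 / 4 by norm_num))).and (h2.eventually (gt_mem_nhds one_pos))).and
    (gt_mem_nhds (zero_lt_one' ℝ))).filter_mono nhdsWithin_le_nhds |>.and
    (self_mem_nhdsWithin (s := Set.Ioi (0 : ℝ)))).exists
  have hε0 : 0 < ε := hε0
  refine ⟨ε, H, hε0, hε3.le, hε2.le, hH2, ?_⟩
  have hpow : (H / 2) ^ (2 - p) * (2 * H) ^ (q - 2) =
      2 ^ (p - 2) * 2 ^ (q - 2) * H ^ (-(p - q)) := by
    rw [Real.div_rpow hH0.le two_pos.le, Real.mul_rpow two_pos.le hH0.le,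
      show 2 - p = -(p - 2) by ring, Real.rpow_neg two_pos.le,
      show -(p - q) = -(p - 2) + (q - 2) by ring, Real.rpow_add hH0, div_inv_eq_mul]
    ring
  have hreal : 2 * ((k₁ : ℝ) * ε ^ 2 + k₂ * (H / 2) ^ (2 - p)) * (2 * H) ^ (q - 2) ≤ 1 / 2 := by
    have : 2 * ((k₁ : ℝ) * ε ^ 2 + k₂ * (H / 2) ^ (2 - p)) * (2 * H) ^ (q - 2) =
        2 * (k₁ : ℝ) * (2 * H) ^ (q - 2) * ε ^ 2 +
          2 * k₂ * ((H / 2) ^ (2 - p) * (2 * H) ^ (q - 2)) := by ring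
    rw [this, hpow]
    linarith
  have hconv : goodLambdaConst d p α₂ C M ε H =
      ENNReal.ofReal ((k₁ : ℝ) * ε ^ 2 + k₂ * (H / 2) ^ (2 - p)) := by
    rw [goodLambdaConst, ← hk₁, ← hk₂, ENNReal.ofReal_add (by positivity) (by positivity),
      ENNReal.ofReal_mul k₁.coe_nonneg, ENNReal.ofReal_mul k₂.coe_nonneg, ENNReal.ofReal_coe_nnreal,
      ENNReal.ofReal_coe_nnreal, ENNReal.ofReal_pow hε0.le, ENNReal.rpow_two,
      ← ENNReal.ofReal_rpow_of_pos (by positivity), ENNReal.ofReal_div_of_pos two_pos]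
    simp
  calc _ = ENNReal.ofReal
        (2 * ((k₁ : ℝ) * ε ^ 2 + k₂ * (H / 2) ^ (2 - p)) * (2 * H) ^ (q - 2)) := by
        rw [hconv, ENNReal.ofReal_mul (by positivity), ENNReal.ofReal_mul two_pos.le]
        simp
    _ ≤ ENNReal.ofReal (1 / 2) := ENNReal.ofReal_le_ofReal hreal
    _ = 1 / 2 := by rw [ENNReal.ofReal_div_of_pos two_pos]; simp

theorem lintegral_enorm_rpow_two_rpow_le {α X : Type*} [MeasurableSpace α] {μ : Measure α}
    [NormedAddCommGroup X] {f : α → X} (hf : AEStronglyMeasurable f μ) {q : ℝ} (hq : 2 < q) :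
    (∫⁻ x, ‖f x‖ₑ ^ (2 : ℝ) ∂μ) ^ (q / 2) ≤
      μ Set.univ ^ (q / 2 - 1) * ∫⁻ x, ‖f x‖ₑ ^ q ∂μ := by
  have h := ENNReal.rpow_le_rpow (eLpNorm'_le_eLpNorm'_mul_rpow_measure_univ
    (by norm_num : (0 : ℝ) < 2) hq.le hf) (z := q) (by linarith)
  rw [eLpNorm'_eq_lintegral_enorm, eLpNorm'_eq_lintegral_enorm,
    ENNReal.mul_rpow_of_nonneg _ _ (by linarith), ← ENNReal.rpow_mul, ← ENNReal.rpow_mul,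
    ← ENNReal.rpow_mul, one_div_mul_cancel (by linarith), ENNReal.rpow_one] at h
  rw [mul_comm]
  convert h using 2
  · ring
  · congr 1
    field_simp

/-- The `L ^ q` bound on bounded compactly supported functions, with a constant that depends on `Ω`
only through its diameter. Below a level `σ` no stopping balls of the required size are available;
if `Ω` is bounded, the contribution of these levels is controlled by Hölder's inequality. -/
theorem exists_lintegral_enorm_rpow_le.{u, v} {d : ℕ} (hd : 0 < d) {p q α₁ α₂ C M : ℝ}
    (hq : 2 < q) (hqp : q < p) (hα₁ : 1 < α₁) (hα₂ : α₁ < α₂) {R₀ δ : ℝ≥0∞} (hR₀ : 0 < R₀)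
    (hδ : δ = ∞ → R₀ = ∞) :
    ∃ A : ℝ≥0∞, A ≠ ∞ ∧ ∀ (X : Type u) (Y : Type v)
      [NormedAddCommGroup X] [NormedSpace ℂ X] [NormedAddCommGroup Y] [NormedSpace ℂ Y]
      (Ω : Set (EuclideanSpace ℝ (Fin d))), NullMeasurableSet Ω volume → ediam Ω = δ →
      ∀ T : Lp X 2 (volume.restrict Ω) →L[ℂ] Lp Y 2 (volume.restrict Ω),
        ‖T‖ ≤ M → WeakReverseHolder Ω T p α₁ α₂ C R₀ →
        ∀ f : Lp X 2 (volume.restrict Ω), IsBoundedCompactlySupported Ω f →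
          ∫⁻ y, ‖T f y‖ₑ ^ q ∂(volume.restrict Ω) ≤
            A * ∫⁻ y, ‖f y‖ₑ ^ q ∂(volume.restrict Ω) := by
  have : NeZero d := ⟨hd.ne'⟩
  obtain ⟨ε, H, hε0, hε, hMε, hH, hη⟩ := exists_goodLambdaConst_mul_le d α₂ C M hq hqp
  have ha : 0 < q - 2 := by linarith
  have hκ : 0 < 6 * (α₂ + 1) := by linarith
  set e := (ENNReal.ofReal ε ^ (2 : ℝ))⁻¹ with he
  have he0 : e ≠ 0 := ENNReal.inv_ne_zero.2
    (ENNReal.rpow_ne_top_of_nonneg (by norm_num) ENNReal.ofReal_ne_top)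
  have het : e ≠ ∞ := ENNReal.inv_ne_top.2 (by simp [hε0])
  by_cases hδt : δ = ∞
  -- If `Ω` is unbounded, then `R₀ = ∞` and every level is available.
  · refine ⟨ENNReal.ofReal (H ^ (q - 2)) * (2 * (e * ENNReal.ofReal ((2 / ε) ^ (q - 2)))),
      by finiteness, fun X Y _ _ _ _ Ω hΩ hdiam T hT hRH f hf => ?_⟩
    refine (lintegral_enorm_rpow_le_of_goodLambda hd hΩ (hq.trans hqp) hα₁ hα₂ hT hRH hf hε0 hε
      hMε hH hq hη le_rfl fun s hs _ => ?_).trans_eq ?_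
    · have hs0 : ENNReal.ofReal s ^ (2 : ℝ) ≠ 0 := by simp [hs]
      have hst : ENNReal.ofReal s ^ (2 : ℝ) ≠ ∞ :=
        ENNReal.rpow_ne_top_of_nonneg (by norm_num) ENNReal.ofReal_ne_top
      have hL : ∫⁻ y, ‖T f y‖ₑ ^ (2 : ℝ) ∂(volume.restrict Ω) +
          e * ∫⁻ y, ‖f y‖ₑ ^ (2 : ℝ) ∂(volume.restrict Ω) ≠ ∞ :=
        ENNReal.add_ne_top.2 ⟨lintegral_enorm_rpow_two_ne_top _,
          ENNReal.mul_ne_top het (lintegral_enorm_rpow_two_ne_top _)⟩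
      obtain ⟨r₀, -, hr₀⟩ := exists_lt_measure_closedBall
        (volume : Measure (EuclideanSpace ℝ (Fin d))) (ENNReal.div_ne_top hL hs0)
      refine ⟨r₀, by rw [hδ hδt]; exact le_top, ?_⟩
      rwa [ENNReal.div_lt_iff (Or.inl hs0) (Or.inl hst), mul_comm (volume _)] at hr₀
    · rw [Real.zero_rpow ha.ne', ENNReal.ofReal_zero, zero_mul, zero_add]
      ring
  · obtain ⟨t, -, ht0, htR⟩ := ENNReal.lt_iff_exists_real_btwn.1 hR₀
    have ht0 : 0 < t := ENNReal.ofReal_pos.1 ht0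
    set r₀ := t / (6 * (α₂ + 1)) with hr₀
    have hr₀0 : 0 < r₀ := by positivity
    have hr₀R : ENNReal.ofReal (6 * (α₂ + 1) * r₀) ≤ R₀ := by
      rw [hr₀, mul_div_cancel₀ _ hκ.ne']; exact htR.le
    set w := volume (closedBall (0 : EuclideanSpace ℝ (Fin d)) r₀) with hw
    have hw0 : w ≠ 0 := (measure_closedBall_pos _ _ hr₀0).ne'
    have hwt : w ≠ ∞ := measure_closedBall_lt_top.ne
    set m := ENNReal.ofReal M ^ (2 : ℝ) with hm
    have hmt : m ≠ ∞ := ENNReal.rpow_ne_top_of_nonneg (by norm_num) ENNReal.ofReal_ne_top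
    -- The factor two in `D` makes the smallness condition for the level `σ` strict.
    set D := 2 * (m + e) / w with hD
    have hDt : D ≠ ∞ := ENNReal.div_ne_top (by finiteness) hw0
    set W := volume (closedBall (0 : EuclideanSpace ℝ (Fin d)) δ.toReal) with hW
    have hWt : W ≠ ∞ := measure_closedBall_lt_top.ne
    refine ⟨ENNReal.ofReal (H ^ (q - 2)) * (2 * (D ^ ((q - 2) / 2) * m * W ^ (q / 2 - 1) +
      e * ENNReal.ofReal ((2 / ε) ^ (q - 2)))), ?_,
      fun X Y _ _ _ _ Ω hΩ hdiam T hT hRH f hf => ?_⟩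
    · have h1 : D ^ ((q - 2) / 2) ≠ ∞ := ENNReal.rpow_ne_top_of_nonneg (by linarith) hDt
      have h2 : W ^ (q / 2 - 1) ≠ ∞ := ENNReal.rpow_ne_top_of_nonneg (by linarith) hWt
      finiteness
    set F := ∫⁻ y, ‖f y‖ₑ ^ (2 : ℝ) ∂(volume.restrict Ω) with hF
    have hFt : F ≠ ∞ := lintegral_enorm_rpow_two_ne_top f
    have hTF : ∫⁻ y, ‖T f y‖ₑ ^ (2 : ℝ) ∂(volume.restrict Ω) ≤ m * F :=
      lintegral_enorm_clm_rpow_two_le T hT f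
    have hDFt : (D * F) ^ (1 / 2 : ℝ) ≠ ∞ :=
      ENNReal.rpow_ne_top_of_nonneg (by norm_num) (ENNReal.mul_ne_top hDt hFt)
    have hΩW : volume Ω ≤ W := by
      rcases Ω.eq_empty_or_nonempty with rfl | ⟨x, hx⟩
      · simp
      · rw [hW, ← Measure.addHaar_closedBall_center volume x]
        refine measure_mono fun y hy => ?_
        rw [mem_closedBall, dist_edist]
        exact ENNReal.toReal_mono hδt (hdiam ▸ edist_le_ediam_of_mem hy hx)
    refine (lintegral_enorm_rpow_le_of_goodLambda hd hΩ (hq.trans hqp) hα₁ hα₂ hT hRH hf hε0 hε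
      hMε hH hq hη (σ := ((D * F) ^ (1 / 2 : ℝ)).toReal) ENNReal.toReal_nonneg
      fun s hs hσs => ⟨r₀, hr₀R, ?_⟩).trans ?_
    · have hs2 : D * F ≤ ENNReal.ofReal s ^ (2 : ℝ) := by
        have h := ENNReal.rpow_le_rpow ((ENNReal.le_ofReal_iff_toReal_le hDFt hs.le).2 hσs)
          (z := 2) (by norm_num)
        rwa [← ENNReal.rpow_mul, one_div_mul_cancel two_ne_zero, ENNReal.rpow_one] at h
      have hle : ∫⁻ y, ‖T f y‖ₑ ^ (2 : ℝ) ∂(volume.restrict Ω) + e * F ≤ (m + e) * F := by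
        rw [add_mul]; gcongr
      refine hle.trans_lt ?_
      rcases eq_or_ne F 0 with hF0 | hF0
      · rw [hF0, mul_zero]
        exact ENNReal.mul_pos (by simp [hs]) hw0
      · have hpos : (m + e) * F ≠ 0 := mul_ne_zero (by simp [he0]) hF0
        have hfin : (m + e) * F ≠ ∞ := by finiteness
        calc (m + e) * F < (m + e) * F + (m + e) * F := ENNReal.lt_add_right hfin hpos
          _ = D * F * w := by
            rw [hD, mul_right_comm, ENNReal.div_mul_cancel hw0 hwt]; ring
          _ ≤ _ := by gcongr
    · have hσ : ENNReal.ofReal (((D * F) ^ (1 / 2 : ℝ)).toReal ^ (q - 2)) =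
          D ^ ((q - 2) / 2) * F ^ ((q - 2) / 2) := by
        rw [← ENNReal.ofReal_rpow_of_nonneg ENNReal.toReal_nonneg ha.le,
          ENNReal.ofReal_toReal hDFt, ← ENNReal.rpow_mul,
          ← ENNReal.mul_rpow_of_nonneg _ _ (by linarith)]
        congr 1; ring
      have hFq : F ^ ((q - 2) / 2) * F ≤
          W ^ (q / 2 - 1) * ∫⁻ y, ‖f y‖ₑ ^ q ∂(volume.restrict Ω) := by
        calc F ^ ((q - 2) / 2) * F = F ^ (q / 2) := by
              conv_lhs => rw [← ENNReal.rpow_one F, ← ENNReal.rpow_mul, one_mul,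
                ← ENNReal.rpow_add_of_nonneg _ _ (by linarith) zero_le_one]
              congr 1; ring
          _ ≤ _ := lintegral_enorm_rpow_two_rpow_le (Lp.aestronglyMeasurable f) hq
          _ ≤ _ := by
            rw [Measure.restrict_apply_univ]
            gcongr
            linarith
      have hlow : D ^ ((q - 2) / 2) * F ^ ((q - 2) / 2) *
          ∫⁻ y, ‖T f y‖ₑ ^ (2 : ℝ) ∂(volume.restrict Ω) ≤
          D ^ ((q - 2) / 2) * m * W ^ (q / 2 - 1) *
            ∫⁻ y, ‖f y‖ₑ ^ q ∂(volume.restrict Ω) := by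
        calc _ ≤ D ^ ((q - 2) / 2) * F ^ ((q - 2) / 2) * (m * F) := by gcongr
          _ = D ^ ((q - 2) / 2) * m * (F ^ ((q - 2) / 2) * F) := by ring
          _ ≤ D ^ ((q - 2) / 2) * m *
            (W ^ (q / 2 - 1) * ∫⁻ y, ‖f y‖ₑ ^ q ∂(volume.restrict Ω)) := by gcongr
          _ = _ := by ring
      rw [hσ, mul_assoc (ENNReal.ofReal (H ^ (q - 2))), mul_assoc (2 : ℝ≥0∞), add_mul]
      exact mul_le_mul_right (mul_le_mul_right (add_le_add_left hlow _) _) _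

/-! ### Approximation and extension -/

/-- Every `L ^ 2` function is approximated in `L ^ 2` by bounded compactly supported functions that
it dominates: the finite measure with density `‖f‖ ^ 2` is inner regular. -/
theorem exists_isBoundedCompactlySupported_norm_sub_le {d : ℕ} {X : Type*}
    [NormedAddCommGroup X] {Ω : Set (EuclideanSpace ℝ (Fin d))}
    (hΩ : NullMeasurableSet Ω volume) (f : Lp X 2 (volume.restrict Ω)) {ε : ℝ} (hε : 0 < ε) :
    ∃ g : Lp X 2 (volume.restrict Ω), IsBoundedCompactlySupported Ω g ∧
      (∀ᵐ x ∂(volume.restrict Ω), ‖g x‖ ≤ ‖f x‖) ∧ ‖f - g‖ ≤ ε := by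
  obtain ⟨Ω', hΩ'Ω, hΩ'm, hΩ'eq⟩ := hΩ.exists_measurable_subset_ae_eq
  have hfm : Measurable fun y => ‖f y‖ₑ ^ (2 : ℝ) := by
    have := (Lp.stronglyMeasurable f).enorm
    fun_prop
  set μ := (volume.restrict Ω).withDensity fun y => ‖f y‖ₑ ^ (2 : ℝ) with hμ
  have hfin : IsFiniteMeasure μ := isFiniteMeasure_withDensity (lintegral_enorm_rpow_two_ne_top f)
  set e := ENNReal.ofReal ε ^ (2 : ℝ) with he
  have he0 : e / 2 ≠ 0 := (ENNReal.half_pos (by simp [he, hε])).ne'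
  set S : ℕ → Set (EuclideanSpace ℝ (Fin d)) := fun n => Ω' ∩ {y | ‖f y‖ ≤ n} with hS
  have hSm : ∀ n, MeasurableSet (S n) := fun n => hΩ'm.inter
    (measurableSet_le (Lp.stronglyMeasurable f).norm.measurable measurable_const)
  have hSU : ⋃ n, S n = Ω' := by
    rw [hS, ← Set.inter_iUnion]
    exact Set.inter_eq_left.2 fun y _ => Set.mem_iUnion.2 (exists_nat_ge ‖f y‖)
  have hμΩ' : μ Ω' = μ Set.univ := by
    refine measure_congr ((withDensity_absolutelyContinuous _ _).ae_eq ?_)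
    have h1 : ∀ᵐ y ∂(volume.restrict Ω), y ∈ Ω := ae_restrict_mem₀ hΩ
    filter_upwards [h1, ae_restrict_of_ae hΩ'eq.mem_iff] with y hy hy'
    exact eq_true (hy'.2 hy)
  have hlim : Filter.Tendsto (fun n => μ (S n)) Filter.atTop (nhds (μ Set.univ)) := by
    rw [← hμΩ', ← hSU]
    refine tendsto_measure_iUnion_atTop fun m n hmn y hy => ⟨hy.1, ?_⟩
    exact le_trans (show ‖f y‖ ≤ m from hy.2) (by exact_mod_cast hmn)
  obtain ⟨n, hn⟩ : ∃ n, μ Set.univ ≤ μ (S n) + e / 2 := by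
    rcases eq_or_ne (μ Set.univ) 0 with h0 | h0
    · exact ⟨0, by rw [h0]; exact zero_le⟩
    · obtain ⟨n, hn⟩ := (hlim.eventually (lt_mem_nhds
        (ENNReal.sub_lt_self (measure_ne_top μ _) h0 he0))).exists
      exact ⟨n, tsub_le_iff_right.1 hn.le⟩
  obtain ⟨K, hKS, hK, hKμ⟩ := (hSm n).exists_isCompact_lt_add (measure_ne_top μ _) he0
  have hKc : μ Kᶜ ≤ e := by
    rw [measure_compl hK.measurableSet (measure_ne_top μ _), tsub_le_iff_left]
    calc μ Set.univ ≤ μ (S n) + e / 2 := hn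
      _ ≤ μ K + e / 2 + e / 2 := by gcongr
      _ = μ K + e := by rw [add_assoc, ENNReal.add_halves]
  obtain ⟨g, h, hfgh, hg, hh⟩ := exists_Lp_indicator_add f hK.measurableSet
  refine ⟨g, ⟨?_, K, hK, hKS.trans (Set.inter_subset_left.trans hΩ'Ω), ?_⟩, ?_, ?_⟩
  · refine memLp_top_of_bound (Lp.aestronglyMeasurable g) n ?_
    filter_upwards [hg] with x hx
    rw [hx]
    by_cases hxK : x ∈ K
    · rw [Set.indicator_of_mem hxK]; exact (hKS hxK).2
    · rw [Set.indicator_of_notMem hxK]; simp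
  · filter_upwards [hg] with x hx hxK
    rw [hx, Set.indicator_of_notMem hxK]
  · filter_upwards [hg] with x hx
    rw [hx]
    exact norm_indicator_le_norm_self _ _
  · have hsub : f - g = h := by rw [hfgh]; abel
    have hint : ‖h‖ₑ ^ (2 : ℝ) ≤ e := by
      rw [← lintegral_enorm_rpow_two_eq]
      refine le_trans (le_of_eq ?_) hKc
      rw [hμ, withDensity_apply _ hK.measurableSet.compl,
        ← lintegral_indicator hK.measurableSet.compl]
      refine lintegral_congr_ae ?_
      filter_upwards [hh] with x hx
      rw [hx]
      by_cases hxK : x ∈ Kᶜ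
      · rw [Set.indicator_of_mem hxK, Set.indicator_of_mem hxK]
      · rw [Set.indicator_of_notMem hxK, Set.indicator_of_notMem hxK]; simp
    rw [hsub]
    rw [he, ENNReal.rpow_le_rpow_iff two_pos, ← ofReal_norm] at hint
    exact (ENNReal.ofReal_le_ofReal_iff hε.le).1 hint

/-- By Fatou's lemma the `L ^ q` bound passes from bounded compactly supported functions to all
of `L ^ 2`. -/
theorem lintegral_enorm_rpow_le_of_isBoundedCompactlySupported {d : ℕ} {X Y : Type*}
    [NormedAddCommGroup X] [NormedSpace ℂ X] [NormedAddCommGroup Y] [NormedSpace ℂ Y]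
    {Ω : Set (EuclideanSpace ℝ (Fin d))} (hΩ : NullMeasurableSet Ω volume)
    (T : Lp X 2 (volume.restrict Ω) →L[ℂ] Lp Y 2 (volume.restrict Ω)) {q : ℝ} (hq : 0 ≤ q)
    {A : ℝ≥0∞}
    (h : ∀ f : Lp X 2 (volume.restrict Ω), IsBoundedCompactlySupported Ω f →
      ∫⁻ y, ‖T f y‖ₑ ^ q ∂(volume.restrict Ω) ≤ A * ∫⁻ y, ‖f y‖ₑ ^ q ∂(volume.restrict Ω))
    (f : Lp X 2 (volume.restrict Ω)) :
    ∫⁻ y, ‖T f y‖ₑ ^ q ∂(volume.restrict Ω) ≤ A * ∫⁻ y, ‖f y‖ₑ ^ q ∂(volume.restrict Ω) := by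
  choose g hg hgf hfg using fun n : ℕ =>
    exists_isBoundedCompactlySupported_norm_sub_le hΩ f (Nat.one_div_pos_of_nat (α := ℝ) (n := n))
  have hlim : Filter.Tendsto g Filter.atTop (nhds f) := by
    rw [tendsto_iff_norm_sub_tendsto_zero]
    refine squeeze_zero (fun n => norm_nonneg _) (fun n => ?_)
      (tendsto_one_div_add_atTop_nhds_zero_nat (𝕜 := ℝ))
    rw [norm_sub_rev]; exact hfg n
  obtain ⟨ns, -, hns⟩ := (tendstoInMeasure_of_tendsto_Lp
    ((T.continuous.tendsto f).comp hlim)).exists_seq_tendsto_ae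
  calc ∫⁻ y, ‖T f y‖ₑ ^ q ∂(volume.restrict Ω)
      = ∫⁻ y, Filter.liminf (fun i => ‖T (g (ns i)) y‖ₑ ^ q) Filter.atTop
          ∂(volume.restrict Ω) := by
        refine lintegral_congr_ae ?_
        filter_upwards [hns] with y hy
        exact ((((ENNReal.continuous_rpow_const (y := q)).tendsto _).comp
          (continuous_enorm.tendsto _)).comp hy).liminf_eq.symm
    _ ≤ Filter.liminf (fun i => ∫⁻ y, ‖T (g (ns i)) y‖ₑ ^ q ∂(volume.restrict Ω))
          Filter.atTop := by
        refine lintegral_liminf_le fun i => ?_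
        have := (Lp.stronglyMeasurable (T (g (ns i)))).enorm
        fun_prop
    _ ≤ Filter.liminf (fun _ : ℕ => A * ∫⁻ y, ‖f y‖ₑ ^ q ∂(volume.restrict Ω))
          Filter.atTop := by
        refine Filter.liminf_le_liminf (Filter.Eventually.of_forall fun i => ?_)
        refine (h _ (hg _)).trans (mul_le_mul_right (lintegral_mono_ae ?_) _)
        filter_upwards [hgf (ns i)] with y hy
        exact ENNReal.rpow_le_rpow (enorm_le_iff_norm_le.2 hy) hq
    _ = _ := Filter.liminf_const _

section Extension

variable {α X : Type*} [MeasurableSpace α] [NormedAddCommGroup X] [NormedSpace ℂ X]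

/-- The subspace `L ^ r ∩ L ^ p` of `L ^ p`. -/
def memLpSubmodule (μ : Measure α) (p r : ℝ≥0∞) : Submodule ℂ (Lp X p μ) where
  carrier := {f | MemLp f r μ}
  add_mem' {f g} hf hg := (hf.add hg).ae_eq (Lp.coeFn_add f g).symm
  zero_mem' := (MemLp.zero (ε := X)).ae_eq (Lp.coeFn_zero X p μ).symm
  smul_mem' c f hf := (hf.const_smul c).ae_eq (Lp.coeFn_smul c f).symm

theorem dense_memLpSubmodule (μ : Measure α) {p r : ℝ≥0∞} [Fact (1 ≤ p)] (hp : p ≠ ∞)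
    (hr0 : r ≠ 0) (hr : r ≠ ∞) :
    DenseRange (memLpSubmodule (X := X) μ p r).subtype := by
  refine (Lp.simpleFunc.denseRange (E := X) (μ := μ) hp).mono ?_
  rintro _ ⟨f, rfl⟩
  have hp0 : p ≠ 0 := (lt_of_lt_of_le one_pos (Fact.out : 1 ≤ p)).ne'
  have h1 : MemLp (Lp.simpleFunc.toSimpleFunc f) r μ :=
    (SimpleFunc.memLp_iff_finMeasSupp hr0 hr).2
      ((SimpleFunc.memLp_iff_finMeasSupp hp0 hp).1 (Lp.simpleFunc.memLp f))
  exact ⟨⟨f.1, h1.ae_eq (Lp.simpleFunc.toSimpleFunc_eq_toFun f)⟩, rfl⟩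

/-- A linear operator on `L ^ 2` that is bounded in the `L ^ q` norm extends to `L ^ q`. -/
theorem exists_clm_Lp_of_lintegral_le {Y : Type*} [NormedAddCommGroup Y] [NormedSpace ℂ Y]
    [CompleteSpace Y] {μ : Measure α} (T : Lp X 2 μ →L[ℂ] Lp Y 2 μ) {q : ℝ} (hq : 0 < q)
    [Fact (1 ≤ ENNReal.ofReal q)] {A : ℝ≥0∞} (hA : A ≠ ∞)
    (h : ∀ f : Lp X 2 μ, ∫⁻ y, ‖T f y‖ₑ ^ q ∂μ ≤ A * ∫⁻ y, ‖f y‖ₑ ^ q ∂μ) :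
    ∃ S : Lp X (ENNReal.ofReal q) μ →L[ℂ] Lp Y (ENNReal.ofReal q) μ,
      ‖S‖ ≤ (A ^ (1 / q)).toReal ∧
      ∀ (f : Lp X 2 μ) (g : Lp X (ENNReal.ofReal q) μ), f =ᵐ[μ] g → T f =ᵐ[μ] S g := by
  have hq0 : ENNReal.ofReal q ≠ 0 := by simp [hq]
  have hAq : A ^ (1 / q) ≠ ∞ := ENNReal.rpow_ne_top_of_nonneg (by positivity) hA
  have hnorm : ∀ f : Lp X 2 μ, eLpNorm (T f) (ENNReal.ofReal q) μ ≤
      A ^ (1 / q) * eLpNorm f (ENNReal.ofReal q) μ := by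
    intro f
    rw [eLpNorm_eq_lintegral_rpow_enorm_toReal hq0 ENNReal.ofReal_ne_top,
      eLpNorm_eq_lintegral_rpow_enorm_toReal hq0 ENNReal.ofReal_ne_top,
      ENNReal.toReal_ofReal hq.le, ← ENNReal.mul_rpow_of_nonneg _ _ (by positivity)]
    exact ENNReal.rpow_le_rpow (h f) (by positivity)
  set D := memLpSubmodule (X := X) μ (ENNReal.ofReal q) 2 with hD
  have hDe : ∀ g : D, MemLp (g : Lp X (ENNReal.ofReal q) μ) 2 μ := fun g => g.2
  have hbd : ∀ g : D, eLpNorm (T ((hDe g).toLp _)) (ENNReal.ofReal q) μ ≤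
      A ^ (1 / q) * eLpNorm (g : Lp X (ENNReal.ofReal q) μ) (ENNReal.ofReal q) μ := fun g => by
    refine (hnorm _).trans_eq ?_
    rw [eLpNorm_congr_ae (MemLp.coeFn_toLp (hDe g))]
  have hmem : ∀ g : D, MemLp (T ((hDe g).toLp _)) (ENNReal.ofReal q) μ := fun g =>
    ⟨Lp.aestronglyMeasurable _, (hbd g).trans_lt
      (ENNReal.mul_lt_top hAq.lt_top (Lp.memLp (g : Lp X (ENNReal.ofReal q) μ)).2)⟩
  let L : D →ₗ[ℂ] Lp Y (ENNReal.ofReal q) μ :=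
    { toFun := fun g => (hmem g).toLp _
      map_add' := fun g₁ g₂ => by
        have hadd : (hDe (g₁ + g₂)).toLp _ = (hDe g₁).toLp _ + (hDe g₂).toLp _ := by
          rw [← MemLp.toLp_add]
          exact MemLp.toLp_congr _ _ (Lp.coeFn_add _ _)
        rw [← MemLp.toLp_add]
        refine MemLp.toLp_congr _ _ ?_
        rw [hadd, map_add]
        exact Lp.coeFn_add _ _
      map_smul' := fun c g => by
        have hsmul : (hDe (c • g)).toLp _ = c • (hDe g).toLp _ := by
          rw [← MemLp.toLp_const_smul]
          exact MemLp.toLp_congr _ _ (Lp.coeFn_smul _ _)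
        rw [RingHom.id_apply, ← MemLp.toLp_const_smul]
        refine MemLp.toLp_congr _ _ ?_
        rw [hsmul, map_smul]
        exact Lp.coeFn_smul _ _ }
  have hdense : DenseRange D.subtype :=
    dense_memLpSubmodule μ ENNReal.ofReal_ne_top two_ne_zero (by norm_num)
  have hL : ∀ g : D, ‖L g‖ ≤ (A ^ (1 / q)).toReal * ‖D.subtype g‖ := fun g => by
    change ‖(hmem g).toLp _‖ ≤ (A ^ (1 / q)).toReal * ‖(g : Lp X (ENNReal.ofReal q) μ)‖
    rw [Lp.norm_toLp, Lp.norm_def, ← ENNReal.toReal_mul]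
    exact ENNReal.toReal_mono (ENNReal.mul_ne_top hAq (Lp.eLpNorm_ne_top _)) (hbd g)
  refine ⟨L.extendOfNorm D.subtype,
    LinearMap.opNorm_extendOfNorm_le hdense ENNReal.toReal_nonneg hL, fun f g hfg => ?_⟩
  have hgD : MemLp g 2 μ := (Lp.memLp f).ae_eq hfg
  have hS := LinearMap.extendOfNorm_eq hdense ⟨_, hL⟩ (⟨g, hgD⟩ : D)
  have hf : f = hgD.toLp g := by
    conv_lhs => rw [← Lp.toLp_coeFn f (Lp.memLp f)]
    exact MemLp.toLp_congr _ _ hfg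
  change L.extendOfNorm D.subtype g = (hmem ⟨g, hgD⟩).toLp _ at hS
  rw [hS, hf]
  exact (MemLp.coeFn_toLp (hmem ⟨g, hgD⟩)).symm

end Extension

theorem mainTheorem2 (d : ℕ) (hd : 2 ≤ d)
    (p q α₁ α₂ C M : ℝ) (hq : 2 < q) (hqp : q < p)
    (hα₁ : 1 < α₁) (hα₂ : α₁ < α₂) (hC : 0 < C) (hM : 0 < M)
    (R₀ δ : ℝ≥0∞) (hR₀ : 0 < R₀) (hδ : δ = ∞ → R₀ = ∞)
    [Fact (1 ≤ ENNReal.ofReal q)] :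
    ∃ A : ℝ, ∀ (X Y : Type*)
      [NormedAddCommGroup X] [NormedSpace ℂ X] [CompleteSpace X]
      [NormedAddCommGroup Y] [NormedSpace ℂ Y] [CompleteSpace Y]
      (Ω : Set (EuclideanSpace ℝ (Fin d))), NullMeasurableSet Ω volume → ediam Ω = δ →
      ∀ T : Lp X 2 (volume.restrict Ω) →L[ℂ] Lp Y 2 (volume.restrict Ω),
        ‖T‖ ≤ M → WeakReverseHolder Ω T p α₁ α₂ C R₀ →
        ∃ S : Lp X (ENNReal.ofReal q) (volume.restrict Ω) →L[ℂ]
            Lp Y (ENNReal.ofReal q) (volume.restrict Ω),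
          ‖S‖ ≤ A ∧
          ∀ (f : Lp X 2 (volume.restrict Ω)) (g : Lp X (ENNReal.ofReal q) (volume.restrict Ω)),
            f =ᵐ[volume.restrict Ω] g → T f =ᵐ[volume.restrict Ω] S g := by
  obtain ⟨A, hA, hbound⟩ := exists_lintegral_enorm_rpow_le (by omega : 0 < d) (C := C) (M := M)
    hq hqp hα₁ hα₂ hR₀ hδ
  refine ⟨(A ^ (1 / q)).toReal, fun X Y _ _ _ _ _ _ Ω hΩ hdiam T hT hRH => ?_⟩
  exact exists_clm_Lp_of_lintegral_le T (by linarith) hA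
    (lintegral_enorm_rpow_le_of_isBoundedCompactlySupported hΩ T (by linarith)
      (hbound X Y Ω hΩ hdiam T hT hRH))
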